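/- Let $\beta>0$, $q=e^{-\beta/2}$, and put $$V(r)=\sum_{m\in\mathbb Z}\frac{1}{4\sin^2[(r+\mathrm i\beta m)/2]},\qquad \theta(r)=\sin(r/2)\prod_{m=1}^\infty\bigl(1-2q^{2m}\cos r+q^{4m}\bigr),\qquad c_0=\frac1{12}-\sum_{m=1}^\infty\frac{1}{2\sinh^2(\beta m/2)}.$$ Let $N\ge 1$ and $\tilde N\ge 1$ be integers and $\lambda=\tilde N/N$. Consider the differential operator $$H_{N,\tilde N}=-\sum_{j=1}^N\frac{\partial^2}{\partial x_j^2}+\sum_{1\le j<k\le N}2\lambda(\lambda-1)V(x_j-x_k)+\lambda\sum_{J=1}^{\tilde N}\frac{\partial^2}{\partial\tilde x_J^2}+\sum_{1\le J<K\le\tilde N}\frac{2(\lambda-1)}{\lambda}V(\tilde x_J-\tilde x_K)+\sum_{j=1}^N\sum_{K=1}^{\tilde N}2(1-\lambda)V(x_j-\tilde x_K)$$ and the function $$\Psi_0^{N,\tilde N}(\mathbf x,\tilde{\mathbf x})=\frac{\Bigl(\prod_{1\le j<k\le N}\theta(x_j-x_k)^{\lambda}\Bigr)\Bigl(\prod_{1\le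 J<K\le\tilde N}\theta(\tilde x_J-\tilde x_K)^{1/\lambda}\Bigr)}{\prod_{j=1}^N\prod_{J=1}^{\tilde N}\theta(x_j-\tilde x_J)}.$$ Then $\Psi_0^{N,\tilde N}$ is an exact eigenfunction of $H_{N,\tilde N}$ with eigenvalue $$E_0=\Bigl(N-\frac{\tilde N^2}{N}\Bigr)c_0 .$$ That is, $\Psi_0^{N,\tilde N}$ is twice continuously differentiable and not identically zero, and $H_{N,\tilde N}\Psi_0^{N,\tilde N}=E_0\Psi_0^{N,\tilde N}$, in each of the following two settings: (i) on the set of all real $(\mathbf x,\tilde{\mathbf x})$ for which no difference of two of the $N+\tilde N$ variables lies in $2\pi\mathbb Z$, where the powers are principal values (negative reals having argument $\pi$); (ii) on every non-empty open set of complex $(\mathbf x,\tilde{\mathbf x})$ on which no difference of two of the variables lies in $2\pi\mathbb Z+\mathrm i\beta\mathbb Z$, where the derivatives are complex derivatives and the powers are $\theta^\lambda=e^{\lambda\log\theta}$ and $\theta^{1/\lambda}=e^{(\log\theta)/\lambda}$, for any choice of continuous branches of $\log\theta(x_j-x_k)$ $(j<k)$ and $\log\theta(\tilde x_J-\tilde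 x_K)$ $(J<K)$ on that set. -/

import Mathlib

noncomputable section

namespace EllipticCS

/-- The nome `q = exp (-β / 2)`. -/
def nome (β : ℝ) : ℝ := Real.exp (-β / 2)

/-- The potential `V(r) = ∑_{m ∈ ℤ} 1 / (4 sin² ((r + i β m) / 2))`. -/
def V (β : ℝ) (r : ℂ) : ℂ :=
  ∑' m : ℤ, 1 / (4 * Complex.sin ((r + Complex.I * β * m) / 2) ^ 2)

/-- `θ(r) = sin (r / 2) ∏_{m ≥ 1} (1 - 2 q^(2m) cos r + q^(4m))`. -/
def theta (β : ℝ) (r : ℂ) : ℂ :=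
  Complex.sin (r / 2) *
    ∏' m : ℕ, (1 - 2 * (nome β : ℂ) ^ (2 * (m + 1)) * Complex.cos r +
      (nome β : ℂ) ^ (4 * (m + 1)))

/-- `c₀ = 1 / 12 - ∑_{m ≥ 1} 1 / (2 sinh² (β m / 2))`. -/
def c0 (β : ℝ) : ℝ :=
  1 / 12 - ∑' m : ℕ, 1 / (2 * Real.sinh (β * ((m : ℝ) + 1) / 2) ^ 2)

/-- Configurations `(x, x̃)` of two groups of variables; here `𝕜` is `ℝ` or `ℂ`. -/
abbrev Config (𝕜 : Type) (N N' : ℕ) : Type := (Fin N → 𝕜) × (Fin N' → 𝕜)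

/-- `r` is not in the period lattice `2πℤ + iβℤ` (the set of poles of `V`, and of zeros of `θ`). -/
def OffLattice (β : ℝ) (r : ℂ) : Prop :=
  ∀ a b : ℤ, r ≠ 2 * Real.pi * a + Complex.I * β * b

section Operator

variable (𝕜 : Type) [NontriviallyNormedField 𝕜] [NormedAlgebra 𝕜 ℂ]

/-- The configurations for which no difference of two of the variables is in the period lattice. -/
def regularConfig (N N' : ℕ) (β : ℝ) : Set (Config 𝕜 N N') :=
  {p | (∀ j k, j ≠ k → OffLattice β (algebraMap 𝕜 ℂ (p.1 j - p.1 k))) ∧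
    (∀ J K, J ≠ K → OffLattice β (algebraMap 𝕜 ℂ (p.2 J - p.2 K))) ∧
    ∀ j K, OffLattice β (algebraMap 𝕜 ℂ (p.1 j - p.2 K))}

/-- The deformed elliptic Calogero-Sutherland operator `H_{N,Ñ}` with coupling `lam`, applied to
the function `Ψ` and evaluated at `p = (x, x̃)`. -/
def deformedCS (N N' : ℕ) (β : ℝ) (lam : ℂ) (Ψ : Config 𝕜 N N' → ℂ) (p : Config 𝕜 N N') : ℂ :=
  -(∑ j : Fin N, iteratedDeriv 2 (fun t : 𝕜 => Ψ (Function.update p.1 j t, p.2)) (p.1 j))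
  + (∑ j : Fin N, ∑ k ∈ Finset.Ioi j,
      2 * lam * (lam - 1) * V β (algebraMap 𝕜 ℂ (p.1 j - p.1 k))) * Ψ p
  + lam * (∑ J : Fin N',
      iteratedDeriv 2 (fun t : 𝕜 => Ψ (p.1, Function.update p.2 J t)) (p.2 J))
  + (∑ J : Fin N', ∑ K ∈ Finset.Ioi J,
      2 * (lam - 1) / lam * V β (algebraMap 𝕜 ℂ (p.2 J - p.2 K))) * Ψ p
  + (∑ j : Fin N, ∑ K : Fin N',
      2 * (1 - lam) * V β (algebraMap 𝕜 ℂ (p.1 j - p.2 K))) * Ψ p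

/-- `Ψ` is a (classical) eigenfunction of `H_{N,Ñ}` with eigenvalue `E` on the set `D`:
it is twice continuously differentiable, not identically zero, and satisfies `H Ψ = E Ψ` on `D`.
For `𝕜 = ℂ` and `D` open, the regularity condition says that `Ψ` is holomorphic. -/
structure IsEigenfunctionOn (N N' : ℕ) (β : ℝ) (lam : ℂ) (D : Set (Config 𝕜 N N'))
    (Ψ : Config 𝕜 N N' → ℂ) (E : ℂ) : Prop where
  contDiffOn : ContDiffOn 𝕜 2 Ψ D
  nonzero : ∃ p ∈ D, Ψ p ≠ 0
  eigen : ∀ p ∈ D, deformedCS 𝕜 N N' β lam Ψ p = E * Ψ p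

end Operator

/-- `Ψ₀^{N,Ñ}` on real configurations. Here `θ` takes real values, and the powers are principal
values; a negative `θ` has argument `π`, so each power is smooth wherever `θ` is non-zero. -/
def psi0 (N N' : ℕ) (β : ℝ) (lam : ℂ) (p : Config ℝ N N') : ℂ :=
  (∏ j : Fin N, ∏ k ∈ Finset.Ioi j, theta β ((p.1 j - p.1 k : ℝ) : ℂ) ^ lam) *
    (∏ J : Fin N', ∏ K ∈ Finset.Ioi J, theta β ((p.2 J - p.2 K : ℝ) : ℂ) ^ (1 / lam)) /
    ∏ j : Fin N, ∏ K : Fin N', theta β ((p.1 j - p.2 K : ℝ) : ℂ)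

/-- `L j k` for `j < k` is a continuous branch on `U` of the logarithm of `θ(x_j - x_k)`, and
`L' J K` for `J < K` is one of the logarithm of `θ(x̃_J - x̃_K)`. -/
structure IsLogBranch (N N' : ℕ) (β : ℝ) (U : Set (Config ℂ N N'))
    (L : Fin N → Fin N → Config ℂ N N' → ℂ) (L' : Fin N' → Fin N' → Config ℂ N N' → ℂ) :
    Prop where
  continuousOn_left : ∀ j k, j < k → ContinuousOn (L j k) U
  exp_left : ∀ j k, j < k → ∀ p ∈ U, Complex.exp (L j k p) = theta β (p.1 j - p.1 k)
  continuousOn_right : ∀ J K, J < K → ContinuousOn (L' J K) U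
  exp_right : ∀ J K, J < K → ∀ p ∈ U, Complex.exp (L' J K p) = theta β (p.2 J - p.2 K)

/-- `Ψ₀^{N,Ñ}` on complex configurations, where `θ(x_j - x_k) ^ lam = exp (lam * L j k)` and
`θ(x̃_J - x̃_K) ^ (1 / lam) = exp (L' J K / lam)` for given branches of the logarithms. -/
def psi0Branch (N N' : ℕ) (β : ℝ) (lam : ℂ) (L : Fin N → Fin N → Config ℂ N N' → ℂ)
    (L' : Fin N' → Fin N' → Config ℂ N N' → ℂ) (p : Config ℂ N N') : ℂ :=
  (∏ j : Fin N, ∏ k ∈ Finset.Ioi j, Complex.exp (lam * L j k p)) *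
    (∏ J : Fin N', ∏ K ∈ Finset.Ioi J, Complex.exp (1 / lam * L' J K p)) /
    ∏ j : Fin N, ∏ K : Fin N', theta β (p.1 j - p.2 K)

end EllipticCS

end

noncomputable section

namespace EllipticCS

open Complex Filter Topology Set

/-! Give each variable a charge `M`: `1` for the `x`, `-1/λ` for the `x̃`. Then Ψ₀ is the product of
the `θ(x_a - x_b) ^ (λ M_a M_b)` over all pairs, the kinetic part of `H` is `-∑ (1/M_a) ∂_a²`, and
the coupling of the pair `a, b` is `λ (M_a + M_b)(λ M_a M_b - 1)`. With `φ = θ'/θ` and `φ' = -V`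
(`hasDerivAt_phi`), the logarithmic gradient is `λ M_a ∑_b M_b φ(x_a - x_b)`. Hence the kinetic part
acts on Ψ₀ as multiplication by `-λ² ∑_a M_a (∑_b M_b φ_ab)² + λ ∑_{a≠b} M_b V_ab`.

The square contains three-body terms `φ_ab φ_ad`. The addition formula `phi_addition` turns their
cyclic sums into two-body terms and the constant `c₀`. The functions `φ²`, which `V` cannot express,
depend on two indices only, so they are multiplied by `∑ M_d`. This vanishes exactly when `λ = Ñ/N`.
What is left (`sum_mul_sq_sum_eq`) is `∑ M_a² M_b V_ab + c₀ ∑ M_a³`: the two-body part cancels the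
potential, and the energy is `-λ² c₀ ∑ M_a³`.

The addition formula follows from Liouville's theorem. As a function of `x`, the difference of its
two sides is doubly periodic because `φ` changes by a constant under each period. The expansions `φ
= 1/x - c₀ x + …` and `V = 1/x² + c₀ + …` show that it tends to `0` at `x = 0`, and the symmetry `x
↦ -x - y` handles `x = -y`.

The real and the complex setting differ only in the branches of the powers. `IsPairFactor` records
what the computation needs of a branch, so that one argument over `𝕜` serves both. -/

/-- The Euler product `∏_{n ≥ 1} (1 - a ^ n u)`. -/
def eulerProd (a u : ℂ) : ℂ := ∏' n : ℕ, (1 - a ^ (n + 1) * u)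

/-- The Lambert-type series `-∑_{n ≥ 1} a ^ n u / (1 - a ^ n u)`, equal to
`u G'(u) / G(u)` for the Euler product `G`. -/
def eulerLogDeriv (a u : ℂ) : ℂ := ∑' n : ℕ, -(a ^ (n + 1) * u) / (1 - a ^ (n + 1) * u)

/-! ### Euler products and their logarithmic derivatives. -/

section EulerProd

variable {a : ℂ}

lemma summable_pow_succ_mul (ha : ‖a‖ < 1) (R : ℝ) :
    Summable fun n : ℕ => ‖a‖ ^ (n + 1) * R :=
  ((summable_nat_add_iff 1).mpr (summable_geometric_of_lt_one (norm_nonneg _) ha)).mul_right R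

lemma summable_norm_eulerProd_factor (ha : ‖a‖ < 1) (u : ℂ) :
    Summable fun n : ℕ => ‖-(a ^ (n + 1) * u)‖ := by
  simpa using summable_pow_succ_mul ha ‖u‖

lemma multipliable_eulerProd (ha : ‖a‖ < 1) (u : ℂ) :
    Multipliable fun n : ℕ => 1 - a ^ (n + 1) * u := by
  simpa [sub_eq_add_neg] using
    multipliable_one_add_of_summable (summable_norm_eulerProd_factor ha u)

lemma hasProdLocallyUniformlyOn_eulerProd (ha : ‖a‖ < 1) (R : ℝ) :
    HasProdLocallyUniformlyOn (fun (n : ℕ) u => 1 - a ^ (n + 1) * u) (eulerProd a)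
      (Metric.ball 0 R) := by
  have := Summable.hasProdLocallyUniformlyOn_nat_one_add (R := ℂ)
    (f := fun (n : ℕ) u => -(a ^ (n + 1) * u))
    (Metric.isOpen_ball (x := (0 : ℂ)) (ε := R)) (summable_pow_succ_mul ha R)
    (.of_forall fun n u hu => ?_) (fun n => by fun_prop)
  · simp only [← sub_eq_add_neg] at this
    exact this
  · rw [norm_neg, norm_mul, norm_pow]
    exact mul_le_mul_of_nonneg_left (by simpa using (Metric.mem_ball.1 hu).le) (by positivity)

lemma differentiable_eulerProd (ha : ‖a‖ < 1) : Differentiable ℂ (eulerProd a) := by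
  intro u
  have h : DifferentiableOn ℂ (eulerProd a) (Metric.ball 0 (‖u‖ + 1)) :=
    (hasProdLocallyUniformlyOn_eulerProd ha _).differentiableOn
      (.of_forall fun _ => by
        simpa [Finset.prod_fn] using DifferentiableOn.finsetProd (fun _ _ => by fun_prop))
      Metric.isOpen_ball
  exact h.differentiableAt (Metric.isOpen_ball.mem_nhds (by simp))

/-- Splitting off the first factor; this is the source of the quasi-periodicity of `θ`. -/
lemma eulerProd_eq_mul (ha : ‖a‖ < 1) (u : ℂ) :
    eulerProd a u = (1 - a * u) * eulerProd a (a * u) := by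
  rw [eulerProd, (tprod_eq_zero_mul' (f := fun n : ℕ => 1 - a ^ (n + 1) * u))]
  · simp only [zero_add, pow_one, eulerProd]
    congr 2
    ext n
    ring
  · convert multipliable_eulerProd ha (a * u) using 2
    ring

lemma norm_pow_succ_mul_le (ha : ‖a‖ < 1) (u : ℂ) (n : ℕ) :
    ‖a ^ (n + 1) * u‖ ≤ ‖a * u‖ := by
  rw [norm_mul, norm_mul, norm_pow]
  gcongr
  exact pow_le_of_le_one (norm_nonneg _) ha.le (by simp)

/-- The first factor is the worst one, so `‖a * u‖ < 1` keeps all factors away from zero. For `a =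
e^{-β}` and `u = e^{±ir}` that condition describes the strip `|Im r| < β`. -/
lemma one_sub_norm_le (ha : ‖a‖ < 1) (u : ℂ) (n : ℕ) :
    1 - ‖a * u‖ ≤ ‖1 - a ^ (n + 1) * u‖ := by
  have := norm_sub_norm_le (1 : ℂ) (a ^ (n + 1) * u)
  have h2 := norm_pow_succ_mul_le ha u n
  rw [norm_one] at this
  linarith

lemma one_sub_pow_succ_mul_ne_zero (ha : ‖a‖ < 1) {u : ℂ} (hu : ‖a * u‖ < 1) (n : ℕ) :
    1 - a ^ (n + 1) * u ≠ 0 := by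
  have := one_sub_norm_le ha u n
  exact norm_pos_iff.1 (by linarith)

lemma eulerProd_ne_zero (ha : ‖a‖ < 1) {u : ℂ} (hu : ‖a * u‖ < 1) : eulerProd a u ≠ 0 := by
  have := tprod_one_add_ne_zero_of_summable (f := fun n : ℕ => -(a ^ (n + 1) * u))
    (fun n => by
      rw [← sub_eq_add_neg]; exact one_sub_pow_succ_mul_ne_zero ha hu n)
    (summable_norm_eulerProd_factor ha u)
  simpa only [eulerProd, sub_eq_add_neg] using this

lemma norm_factor_logDeriv_le (ha : ‖a‖ < 1) {R : ℝ} (hR : ‖a‖ * R < 1) {u : ℂ} (hu : ‖u‖ < R)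
    (n : ℕ) :
    ‖-(a ^ (n + 1) * u) / (1 - a ^ (n + 1) * u)‖ ≤ ‖a‖ ^ (n + 1) * (R / (1 - ‖a‖ * R)) := by
  have h1 := one_sub_norm_le ha u n
  have h2 : ‖a * u‖ ≤ ‖a‖ * R := by rw [norm_mul]; gcongr
  have h3 : 0 < 1 - ‖a‖ * R := by linarith
  rw [norm_div, norm_neg, norm_mul, norm_pow, mul_div_assoc]
  have : 0 ≤ R := (norm_nonneg u).trans hu.le
  gcongr
  linarith

lemma exists_radius {u : ℂ} (hu : ‖a * u‖ < 1) : ∃ R : ℝ, ‖u‖ < R ∧ ‖a‖ * R < 1 := by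
  rw [norm_mul] at hu
  rcases eq_or_ne a 0 with rfl | h
  · exact ⟨‖u‖ + 1, by simp, by simp⟩
  · have h0 : 0 < ‖a‖ := norm_pos_iff.2 h
    have h1 : ‖u‖ < 1 / ‖a‖ := by rwa [lt_div_iff₀ h0, mul_comm]
    obtain ⟨R, h2, h3⟩ := exists_between h1
    exact ⟨R, h2, by rwa [lt_div_iff₀ h0, mul_comm] at h3⟩

lemma hasDerivAt_factor_logDeriv (ha : ‖a‖ < 1) {u : ℂ} (hu : ‖a * u‖ < 1) (n : ℕ) :
    HasDerivAt (fun u => -(a ^ (n + 1) * u) / (1 - a ^ (n + 1) * u))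
      (-a ^ (n + 1) / (1 - a ^ (n + 1) * u) ^ 2) u := by
  have h0 := one_sub_pow_succ_mul_ne_zero ha hu n
  have h := ((hasDerivAt_id u).const_mul (a ^ (n + 1)))
  refine (h.neg.div (h.const_sub 1) h0).congr_deriv ?_
  simp only [id, mul_one, Pi.neg_apply]
  congr 1
  ring

/-- Termwise logarithmic differentiation. The series is matched with `u * d` because the chain rule
for `u = e^{±ir}` supplies the factor `u`. -/
lemma hasDerivAt_eulerProd (ha : ‖a‖ < 1) {u : ℂ} (hu : ‖a * u‖ < 1) :
    ∃ d, HasDerivAt (eulerProd a) (eulerProd a u * d) u ∧ u * d = eulerLogDeriv a u := by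
  obtain ⟨R, huR, hR⟩ := exists_radius hu
  have h0 := eulerProd_ne_zero ha hu
  refine ⟨logDeriv (eulerProd a) u, ?_, ?_⟩
  · rw [logDeriv_apply, mul_div_cancel₀ _ h0]
    exact (differentiable_eulerProd ha u).hasDerivAt
  · have hld (n : ℕ) : logDeriv (fun u => 1 - a ^ (n + 1) * u) u =
        -a ^ (n + 1) / (1 - a ^ (n + 1) * u) := by
      rw [logDeriv_apply]
      congr 1
      simp
    have hs : Summable fun n : ℕ => -a ^ (n + 1) / (1 - a ^ (n + 1) * u) := by
      refine Summable.of_norm_bounded (summable_pow_succ_mul ha (1 / (1 - ‖a * u‖))) fun n => ?_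
      have h1 := one_sub_norm_le ha u n
      rw [norm_div, norm_neg, norm_pow, mul_one_div]
      gcongr
    have := logDeriv_tprod_eq_tsum (f := fun (n : ℕ) u => 1 - a ^ (n + 1) * u)
      Metric.isOpen_ball (x := u) (s := Metric.ball 0 R) (by simpa using huR)
      (one_sub_pow_succ_mul_ne_zero ha hu) (fun n => by fun_prop) (by simpa only [hld] using hs)
      (hasProdLocallyUniformlyOn_eulerProd ha R).multipliableLocallyUniformlyOn h0
    change logDeriv (eulerProd a) u = _ at this
    rw [this, eulerLogDeriv, ← tsum_mul_left]
    congr 1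
    ext n
    rw [hld]
    ring

lemma hasDerivAt_eulerLogDeriv (ha : ‖a‖ < 1) {u : ℂ} (hu : ‖a * u‖ < 1) :
    ∃ d, HasSum (fun n : ℕ => -a ^ (n + 1) / (1 - a ^ (n + 1) * u) ^ 2) d ∧
      HasDerivAt (eulerLogDeriv a) d u := by
  obtain ⟨R, huR, hR⟩ := exists_radius hu
  have hball {w : ℂ} (hw : w ∈ Metric.ball (0 : ℂ) R) : ‖a * w‖ < 1 := by
    rw [norm_mul]
    refine lt_of_le_of_lt (mul_le_mul_of_nonneg_left ?_ (norm_nonneg _)) hR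
    simpa using (Metric.mem_ball.1 hw).le
  have hu' : u ∈ Metric.ball (0 : ℂ) R := by simpa using huR
  have hd (n : ℕ) : DifferentiableOn ℂ (fun u => -(a ^ (n + 1) * u) / (1 - a ^ (n + 1) * u))
      (Metric.ball 0 R) := fun w hw =>
    (hasDerivAt_factor_logDeriv ha (hball hw) n).differentiableAt.differentiableWithinAt
  have hb (n : ℕ) (w : ℂ) (hw : w ∈ Metric.ball (0 : ℂ) R) :=
    norm_factor_logDeriv_le ha hR (mem_ball_zero_iff.1 hw) n
  have hs := summable_pow_succ_mul ha (R / (1 - ‖a‖ * R))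
  refine ⟨_, ?_, ((differentiableOn_tsum_of_summable_norm hs hd Metric.isOpen_ball
    hb).differentiableAt (Metric.isOpen_ball.mem_nhds hu')).hasDerivAt⟩
  have := hasSum_deriv_of_summable_norm hs hd Metric.isOpen_ball hb hu'
  simpa only [(hasDerivAt_factor_logDeriv ha hu _).deriv] using this

end EulerProd

lemma norm_exp_neg_lt_one {β : ℝ} (hβ : 0 < β) : ‖cexp (-β)‖ < 1 := by
  rw [Complex.norm_exp]; simpa using hβ

/-! ### The theta function: zeros, quasi-periods and logarithmic derivative in a strip. -/

section Theta

variable {β : ℝ}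

/-- The factor `∏_{m ≥ 1} (1 - 2 q ^ (2m) cos r + q ^ (4m))` of `θ(r)`. -/
def thetaProd (β : ℝ) (r : ℂ) : ℂ :=
  eulerProd (cexp (-β)) (cexp (I * r)) * eulerProd (cexp (-β)) (cexp (-(I * r)))

lemma theta_eq (hβ : 0 < β) (r : ℂ) : theta β r = sin (r / 2) * thetaProd β r := by
  have ha := norm_exp_neg_lt_one hβ
  rw [theta, thetaProd, eulerProd, eulerProd,
    ← (multipliable_eulerProd ha _).tprod_mul (multipliable_eulerProd ha _)]
  congr 2
  ext m
  have h1 : (nome β : ℂ) ^ 2 = cexp (-β) := by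
    rw [nome, Complex.ofReal_exp, ← Complex.exp_nat_mul]; congr 1; push_cast; ring
  rw [pow_mul, show 4 * (m + 1) = 2 * (2 * (m + 1)) by ring, pow_mul _ 2 (2 * (m + 1)), h1,
    Complex.cos, mul_comm r I, neg_mul, mul_comm r I]
  have h2 : cexp (I * r) * cexp (-(I * r)) = 1 := by rw [← Complex.exp_add]; simp
  linear_combination (-(cexp (-β) ^ (m + 1)) ^ 2) * h2

lemma thetaProd_neg (r : ℂ) : thetaProd β (-r) = thetaProd β r := by
  simp only [thetaProd, mul_neg, neg_neg]; ring

lemma thetaProd_add_two_pi (r : ℂ) : thetaProd β (r + 2 * Real.pi) = thetaProd β r := by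
  have h1 : I * (r + 2 * Real.pi) = I * r + 2 * Real.pi * I := by ring
  have h2 : -(I * r + 2 * Real.pi * I) = -(I * r) - 2 * Real.pi * I := by ring
  simp only [thetaProd, h1, h2, Complex.exp_periodic _, Complex.exp_periodic.sub_eq]

lemma theta_neg (hβ : 0 < β) (r : ℂ) : theta β (-r) = -theta β r := by
  rw [theta_eq hβ, theta_eq hβ, thetaProd_neg, neg_div, Complex.sin_neg, neg_mul]

lemma theta_zero (hβ : 0 < β) : theta β 0 = 0 := by simp [theta_eq hβ]

lemma theta_add_two_pi (hβ : 0 < β) (r : ℂ) : theta β (r + 2 * Real.pi) = -theta β r := by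
  rw [theta_eq hβ, theta_eq hβ, thetaProd_add_two_pi,
    show (r + 2 * Real.pi) / 2 = r / 2 + Real.pi by ring, Complex.sin_add_pi, neg_mul]

lemma theta_eq_exp (hβ : 0 < β) (r : ℂ) :
    theta β r = cexp (I * r / 2) * (1 - cexp (-(I * r))) / (2 * I) * thetaProd β r := by
  rw [theta_eq hβ, Complex.sin]
  congr 1
  have h1 : cexp (-(I * r)) = cexp (-(I * r / 2)) * cexp (-(I * r / 2)) := by
    rw [← Complex.exp_add]; ring_nf
  have h2 : cexp (I * r / 2) * cexp (-(I * r / 2)) = 1 := by rw [← Complex.exp_add]; simp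
  rw [h1, show -(r / 2) * I = -(I * r / 2) by ring, show r / 2 * I = I * r / 2 by ring,
    div_eq_div_iff two_ne_zero (by simp)]
  linear_combination
    2 * (cexp (-(I * r / 2)) - cexp (I * r / 2)) * I_sq + 2 * cexp (-(I * r / 2)) * h2

/-- The shift replaces `e^{ir}` by `a e^{ir}` and `e^{-ir}` by `a⁻¹ e^{-ir}` with `a = e^{-β}`. One
Euler product loses its first factor and the other gains one; these combine with the two factors
coming from the sine to leave the multiplier. -/
lemma theta_add_I_mul (hβ : 0 < β) (r : ℂ) :
    theta β (r + I * β) = -cexp (β / 2) * cexp (-(I * r)) * theta β r := by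
  have ha := norm_exp_neg_lt_one hβ
  have h1 : cexp (I * (r + I * β)) = cexp (-β) * cexp (I * r) := by
    rw [← Complex.exp_add]; congr 1; linear_combination β * I_sq
  have h2 : cexp (-(I * r)) = cexp (-β) * cexp (-(I * (r + I * β))) := by
    rw [← Complex.exp_add]; congr 1; linear_combination β * I_sq
  have h3 := eulerProd_eq_mul ha (cexp (I * r))
  have h4 := eulerProd_eq_mul ha (cexp (-(I * (r + I * β))))
  rw [← h1] at h3
  rw [← h2] at h4
  have h5 : cexp (-(I * (r + I * β))) = cexp (β / 2) * cexp (β / 2) * cexp (-(I * r)) := by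
    rw [← Complex.exp_add, ← Complex.exp_add]; congr 1; linear_combination -β * I_sq
  have h6 : cexp (I * (r + I * β) / 2) * cexp (β / 2) = cexp (I * r / 2) := by
    rw [← Complex.exp_add]; congr 1; linear_combination β / 2 * I_sq
  -- The new sine factor is a multiple of the factor `1 - a e^{ir}` lost by the first Euler product.
  have h7 : (1 - cexp (-(I * (r + I * β)))) =
      -cexp (β / 2) * cexp (β / 2) * cexp (-(I * r)) * (1 - cexp (-β) * cexp (I * r)) := by
    have e : cexp (β / 2) * cexp (β / 2) * cexp (-(I * r)) * (cexp (-β) * cexp (I * r)) = 1 := by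
      simp only [← Complex.exp_add]
      rw [Complex.exp_eq_one_iff]
      exact ⟨0, by push_cast; ring⟩
    rw [h5]
    linear_combination -e
  rw [theta_eq_exp hβ, theta_eq_exp hβ, thetaProd, thetaProd, h4, h3, h7, ← h6, ← h1]
  ring

lemma norm_mul_exp_lt (r : ℂ) (hr : |r.im| < β) :
    ‖cexp (-β) * cexp (I * r)‖ < 1 ∧ ‖cexp (-β) * cexp (-(I * r))‖ < 1 := by
  rw [← Complex.exp_add, ← Complex.exp_add, Complex.norm_exp, Complex.norm_exp]
  rw [abs_lt] at hr
  constructor <;> rw [Real.exp_lt_one_iff] <;> simp <;> linarith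

lemma thetaProd_ne_zero (hβ : 0 < β) {r : ℂ} (hr : |r.im| < β) : thetaProd β r ≠ 0 :=
  mul_ne_zero (eulerProd_ne_zero (norm_exp_neg_lt_one hβ) (norm_mul_exp_lt r hr).1)
    (eulerProd_ne_zero (norm_exp_neg_lt_one hβ) (norm_mul_exp_lt r hr).2)

lemma differentiable_thetaProd (hβ : 0 < β) : Differentiable ℂ (thetaProd β) := by
  have h := differentiable_eulerProd (norm_exp_neg_lt_one hβ)
  have h1 : Differentiable ℂ fun r : ℂ => cexp (I * r) := by fun_prop
  have h2 : Differentiable ℂ fun r : ℂ => cexp (-(I * r)) := by fun_prop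
  exact (h.comp h1).mul (h.comp h2)

lemma differentiable_theta (hβ : 0 < β) : Differentiable ℂ (theta β) := by
  have h : theta β = fun r => sin (r / 2) * thetaProd β r := funext (theta_eq hβ)
  rw [h]
  have := differentiable_thetaProd hβ
  fun_prop

/-- The logarithmic derivative of `thetaProd β` in the strip `|Im r| < β`. -/
def thetaProdLogDeriv (β : ℝ) (r : ℂ) : ℂ :=
  I * (eulerLogDeriv (cexp (-β)) (cexp (I * r)) - eulerLogDeriv (cexp (-β)) (cexp (-(I * r))))

lemma hasDerivAt_exp_I_mul (r : ℂ) : HasDerivAt (fun r => cexp (I * r)) (cexp (I * r) * I) r := by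
  simpa using ((hasDerivAt_id r).const_mul I).cexp

lemma hasDerivAt_exp_neg_I_mul (r : ℂ) :
    HasDerivAt (fun r => cexp (-(I * r))) (cexp (-(I * r)) * -I) r := by
  simpa using ((hasDerivAt_id r).const_mul I).neg.cexp

lemma hasDerivAt_thetaProd (hβ : 0 < β) {r : ℂ} (hr : |r.im| < β) :
    HasDerivAt (thetaProd β) (thetaProd β r * thetaProdLogDeriv β r) r := by
  have ha := norm_exp_neg_lt_one hβ
  obtain ⟨d, hd, hd'⟩ := hasDerivAt_eulerProd ha (norm_mul_exp_lt r hr).1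
  obtain ⟨e, he, he'⟩ := hasDerivAt_eulerProd ha (norm_mul_exp_lt r hr).2
  refine ((hd.comp r (hasDerivAt_exp_I_mul r)).mul
    (he.comp r (hasDerivAt_exp_neg_I_mul r))).congr_deriv ?_
  rw [thetaProd, thetaProdLogDeriv, ← hd', ← he']
  simp only [Function.comp]
  ring

/-- With `u = e^{2iw}` and `v = u⁻¹`, one has `4 sin² w = -v (1 - u)²`. At `u = 1` both sides are
`0` by the convention for division by zero. -/
lemma inv_four_mul_sin_sq {u v w : ℂ} (huv : u * v = 1) (hw : cexp (I * w) ^ 2 = u) :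
    1 / (4 * sin w ^ 2) = -u / (1 - u) ^ 2 := by
  have h2 : cexp (I * w) * cexp (-(I * w)) = 1 := by rw [← Complex.exp_add]; simp
  have h3 : 4 * sin w ^ 2 = -v * (1 - u) ^ 2 := by
    rw [Complex.sin, mul_comm w I, neg_mul, mul_comm w I]
    have h4 : v = cexp (-(I * w)) ^ 2 := by
      linear_combination (-v * (cexp (I * w) * cexp (-(I * w)) + 1)) * h2
        + cexp (-(I * w)) ^ 2 * huv + v * cexp (-(I * w)) ^ 2 * hw
    linear_combination (cexp (-(I * w)) - cexp (I * w)) ^ 2 * I_sq + h4 + 2 * h2 - hw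
      + (u - 2) * huv
  have hv : v ≠ 0 := right_ne_zero_of_mul_eq_one huv
  rw [h3]
  rcases eq_or_ne (1 - u) 0 with h | h
  · simp [h]
  · field_simp
    linear_combination huv

end Theta

/-! ### The potential as a derivative of Lambert series, and the constant `c₀`. -/

section Potential

variable {β : ℝ}

lemma V_term_pos (r : ℂ) (n : ℕ) :
    1 / (4 * sin ((r + I * β * ((n + 1 : ℕ) : ℤ)) / 2) ^ 2) =
      cexp (I * r) * (-cexp (-β) ^ (n + 1) / (1 - cexp (-β) ^ (n + 1) * cexp (I * r)) ^ 2) := by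
  have h1 : cexp (-β) ^ (n + 1) * cexp (I * r) = cexp (I * r - β * (n + 1)) := by
    rw [← Complex.exp_nat_mul, ← Complex.exp_add]; congr 1; push_cast; ring
  rw [inv_four_mul_sin_sq (u := cexp (I * r - β * (n + 1)))
    (v := cexp (-(I * r - β * (n + 1)))), ← h1]
  · ring
  · rw [← Complex.exp_add]; simp
  · rw [← Complex.exp_nat_mul]
    congr 1
    push_cast
    linear_combination β * (n + 1) * I_sq

lemma V_term_neg (r : ℂ) (m : ℤ) :
    1 / (4 * sin ((-r + I * β * (-m : ℤ)) / 2) ^ 2) =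
      1 / (4 * sin ((r + I * β * m) / 2) ^ 2) := by
  rw [show (-r + I * β * (-m : ℤ)) / 2 = -((r + I * β * m) / 2) by push_cast; ring,
    Complex.sin_neg, neg_sq]

lemma V_term_neg_succ (r : ℂ) (n : ℕ) :
    1 / (4 * sin ((r + I * β * (-((n : ℤ) + 1) : ℤ)) / 2) ^ 2) =
      1 / (4 * sin ((-r + I * β * ((n + 1 : ℕ) : ℤ)) / 2) ^ 2) := by
  have := V_term_neg (β := β) (-r) ((n + 1 : ℕ) : ℤ)
  rwa [neg_neg] at this

lemma V_neg (r : ℂ) : V β (-r) = V β r := by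
  rw [V, V, ← (Equiv.neg ℤ).tsum_eq]
  exact tsum_congr fun m => V_term_neg r m

lemma V_add_two_pi (r : ℂ) : V β (r + 2 * Real.pi) = V β r := by
  rw [V, V]
  refine tsum_congr fun m => ?_
  rw [show (r + 2 * Real.pi + I * β * m) / 2 = (r + I * β * m) / 2 + Real.pi by ring,
    Complex.sin_add_pi, neg_sq]

lemma V_add_I_mul (r : ℂ) : V β (r + I * β) = V β r := by
  rw [V, V, ← (Equiv.addRight (1 : ℤ)).tsum_eq
    (fun m : ℤ => 1 / (4 * sin ((r + I * β * m) / 2) ^ 2))]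
  refine tsum_congr fun m => ?_
  simp only [Equiv.coe_addRight]
  push_cast
  ring_nf

/-- The two Lambert series differentiate termwise into minus the terms `m ≥ 1` and `m ≤ -1` of `V`.
The subtracted `m = 0` term is the only one singular in the strip; at its poles it is `0` by default
on both occurrences, so `r = 0` is included. -/
lemma hasDerivAt_thetaProdLogDeriv (hβ : 0 < β) {r : ℂ} (hr : |r.im| < β) :
    HasDerivAt (thetaProdLogDeriv β) (1 / (4 * sin (r / 2) ^ 2) - V β r) r := by
  have ha := norm_exp_neg_lt_one hβ
  obtain ⟨d, hd, hd'⟩ := hasDerivAt_eulerLogDeriv ha (norm_mul_exp_lt r hr).1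
  obtain ⟨e, he, he'⟩ := hasDerivAt_eulerLogDeriv ha (norm_mul_exp_lt r hr).2
  have h1 : HasSum (fun n : ℕ => 1 / (4 * sin ((r + I * β * (n : ℤ)) / 2) ^ 2))
      (1 / (4 * sin (r / 2) ^ 2) + cexp (I * r) * d) := by
    have := (hd.mul_left (cexp (I * r)))
    simp only [← V_term_pos] at this
    have h := (hasSum_nat_add_iff
      (f := fun n : ℕ => 1 / (4 * sin ((r + I * β * (n : ℤ)) / 2) ^ 2)) 1).1 this
    simpa [add_comm] using h
  have h2 : HasSum (fun n : ℕ => 1 / (4 * sin ((r + I * β * (-((n : ℤ) + 1) : ℤ)) / 2) ^ 2))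
      (cexp (-(I * r)) * e) := by
    have := he.mul_left (cexp (-(I * r)))
    simp only [← mul_neg, ← V_term_pos] at this
    simpa only [V_term_neg_succ, mul_neg] using this
  have hV : V β r = 1 / (4 * sin (r / 2) ^ 2) + cexp (I * r) * d + cexp (-(I * r)) * e := by
    rw [V]
    exact (HasSum.of_nat_of_neg_add_one
      (f := fun m : ℤ => 1 / (4 * sin ((r + I * β * m) / 2) ^ 2)) h1 h2).tsum_eq
  refine (((hd'.comp r (hasDerivAt_exp_I_mul r)).sub
    (he'.comp r (hasDerivAt_exp_neg_I_mul r))).const_mul I).congr_deriv ?_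
  rw [hV]
  linear_combination (d * cexp (I * r) + e * cexp (-(I * r))) * I_sq

/-- The term `m = 0` of `V β 0` is `1 / 0 = 0`, so that `V β 0` is the sum over `m ≠ 0`. -/
lemma c0_eq (hβ : 0 < β) : (c0 β : ℂ) = 1 / 12 + V β 0 := by
  have ha := norm_exp_neg_lt_one hβ
  obtain ⟨d, hd, -⟩ := hasDerivAt_eulerLogDeriv ha (u := 1) (by simpa using ha)
  have hterm (n : ℕ) : 1 / (4 * sin ((0 + I * β * ((n + 1 : ℕ) : ℤ)) / 2) ^ 2) =
      -((1 / (2 * Real.sinh (β * ((n : ℝ) + 1) / 2) ^ 2) : ℝ) : ℂ) / 2 := by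
    rw [show (0 + I * β * ((n + 1 : ℕ) : ℤ)) / 2 = (β * (n + 1) / 2) * I by push_cast; ring,
      Complex.sin_mul_I]
    push_cast
    rw [mul_pow, I_sq]
    have : Complex.sinh (β * (n + 1) / 2) ≠ 0 := by
      have : Real.sinh (β * (n + 1) / 2) ≠ 0 := by
        rw [Ne, Real.sinh_eq_zero]; positivity
      exact_mod_cast this
    field_simp
    ring
  have h0 : HasSum (fun n : ℕ => 1 / (4 * sin ((0 + I * β * ((n + 1 : ℕ) : ℤ)) / 2) ^ 2)) d := by
    simp only [V_term_pos]
    simpa using hd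
  have h1 : HasSum (fun n : ℕ => 1 / (4 * sin ((0 + I * β * (n : ℤ)) / 2) ^ 2)) d := by
    have h := (hasSum_nat_add_iff
      (f := fun n : ℕ => 1 / (4 * sin ((0 + I * β * (n : ℤ)) / 2) ^ 2)) 1).1 h0
    simpa using h
  have h2 : HasSum (fun n : ℕ => 1 / (4 * sin ((0 + I * β * (-((n : ℤ) + 1) : ℤ)) / 2) ^ 2))
      d := by
    simpa only [V_term_neg_succ, neg_zero] using h0
  have hV : V β 0 = d + d := by
    rw [V]
    exact (HasSum.of_nat_of_neg_add_one
      (f := fun m : ℤ => 1 / (4 * sin ((0 + I * β * m) / 2) ^ 2)) h1 h2).tsum_eq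
  simp only [hterm] at h0
  -- Since `sin(iy)² = -sinh² y`, each term of `V` is `-1/2` times a term of the series in `c0`. The
  -- sums over `m > 0` and `m < 0` agree, so both that series and `V β 0` are expressed by `d`.
  have h3 : HasSum (fun n : ℕ => ((1 / (2 * Real.sinh (β * ((n : ℝ) + 1) / 2) ^ 2) : ℝ) : ℂ))
      (-2 * d) := by
    refine Eq.mp (congrArg (fun f => HasSum f (-2 * d)) (funext fun n => ?_)) (h0.mul_left (-2))
    ring
  rw [c0, Complex.ofReal_sub, Complex.ofReal_tsum, h3.tsum_eq, hV]
  push_cast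
  ring

end Potential

/-! ### The logarithmic derivative `φ` on the whole plane. -/

section ThetaLogDeriv

variable {β : ℝ}

/-- The logarithmic derivative `θ' / θ`. -/
def phi (β : ℝ) (r : ℂ) : ℂ := logDeriv (theta β) r

lemma hasDerivAt_theta (hβ : 0 < β) {r : ℂ} (hr : theta β r ≠ 0) :
    HasDerivAt (theta β) (theta β r * phi β r) r := by
  rw [phi, logDeriv_apply, mul_div_cancel₀ _ hr]
  exact (differentiable_theta hβ r).hasDerivAt

lemma phi_eq_of_hasDerivAt {r d : ℂ} (hr : theta β r ≠ 0)
    (h : HasDerivAt (theta β) (theta β r * d) r) : phi β r = d := by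
  rw [phi, logDeriv_apply, h.deriv, mul_div_cancel_left₀ _ hr]

lemma phi_neg (hβ : 0 < β) (r : ℂ) : phi β (-r) = -phi β r := by
  have h1 : (fun r => theta β (-r)) = fun r => -theta β r := funext (theta_neg hβ)
  have h2 := congrArg (fun f => deriv f r) h1
  simp only [deriv_comp_neg, deriv.fun_neg, neg_inj] at h2
  rw [phi, phi, logDeriv_apply, logDeriv_apply, h2, theta_neg hβ, div_neg]

lemma phi_add_two_pi (hβ : 0 < β) (r : ℂ) : phi β (r + 2 * Real.pi) = phi β r := by
  have h1 : (fun r => theta β (r + 2 * Real.pi)) = fun r => -theta β r :=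
    funext (theta_add_two_pi hβ)
  have h2 := congrArg (fun f => deriv f r) h1
  simp only [deriv_comp_add_const, deriv.fun_neg] at h2
  rw [phi, phi, logDeriv_apply, logDeriv_apply, h2, theta_add_two_pi hβ, neg_div_neg_eq]

/-- `θ` itself is only quasi-periodic, but its vanishing, as a `Prop`-valued function, is periodic,
so `Function.Periodic.int_mul` covers all integer translates. -/
lemma periodic_theta_eq_zero (hβ : 0 < β) :
    Function.Periodic (fun r => theta β r = 0) (I * β) := fun r => by
  simp [theta_add_I_mul hβ]

lemma periodic_theta_eq_zero_two_pi (hβ : 0 < β) :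
    Function.Periodic (fun r => theta β r = 0) (2 * Real.pi) := fun r => by
  simp [theta_add_two_pi hβ]

lemma phi_add_I_mul (hβ : 0 < β) {r : ℂ} (hr : theta β r ≠ 0) :
    phi β (r + I * β) = phi β r - I := by
  have h1 : (fun r => theta β (r + I * β)) =
      fun r => -cexp (β / 2) * cexp (-(I * r)) * theta β r := funext (theta_add_I_mul hβ)
  have h2 := ((hasDerivAt_exp_neg_I_mul r).const_mul (-cexp (β / 2))).mul (hasDerivAt_theta hβ hr)
  have h3 := congrArg (fun f => deriv f r) h1
  rw [deriv_comp_add_const] at h3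
  replace h3 := h3.trans h2.deriv
  have h4 : theta β (r + I * β) ≠ 0 := by simpa [theta_add_I_mul hβ] using hr
  rw [phi, logDeriv_apply, h3, div_eq_iff h4, theta_add_I_mul hβ]
  ring

lemma exists_abs_im_add_lt (hβ : 0 < β) (r : ℂ) : ∃ n : ℤ, |(r + n * (I * β)).im| < β := by
  refine ⟨-round (r.im / β), ?_⟩
  have h := abs_sub_round (r.im / β)
  have : (r + ((-round (r.im / β) : ℤ) : ℂ) * (I * β)).im
      = (r.im / β - round (r.im / β)) * β := by
    simp
    field_simp
    ring
  rw [this, abs_mul, abs_of_pos hβ]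
  nlinarith

/-- After translation into the strip `|Im r| < β` the Euler products do not vanish, and only the
zeros of the sine remain. -/
lemma theta_eq_zero_iff (hβ : 0 < β) {r : ℂ} :
    theta β r = 0 ↔ ∃ a b : ℤ, r = 2 * Real.pi * a + I * β * b := by
  constructor
  · intro h
    obtain ⟨n, hn⟩ := exists_abs_im_add_lt hβ r
    have h1 : theta β (r + n * (I * β)) = 0 := by
      exact (iff_of_eq ((periodic_theta_eq_zero hβ).int_mul n r)).2 h
    rw [theta_eq hβ, mul_eq_zero, or_iff_left (thetaProd_ne_zero hβ hn),
      Complex.sin_eq_zero_iff] at h1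
    obtain ⟨k, hk⟩ := h1
    exact ⟨k, -n, by push_cast; linear_combination 2 * hk⟩
  · rintro ⟨a, b, rfl⟩
    have h1 := (periodic_theta_eq_zero hβ).int_mul b (2 * Real.pi * a)
    have h2 := (periodic_theta_eq_zero_two_pi hβ).int_mul a 0
    simp only [zero_add, theta_zero hβ] at h2
    rw [mul_comm (I * (β : ℂ)), h1, mul_comm, h2]
    trivial

lemma offLattice_iff (hβ : 0 < β) {r : ℂ} : OffLattice β r ↔ theta β r ≠ 0 := by
  rw [Ne, theta_eq_zero_iff hβ, OffLattice]
  push Not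
  rfl

lemma eventually_abs_im_lt {r : ℂ} (hr : |r.im| < β) : ∀ᶠ s in 𝓝 r, |s.im| < β :=
  (continuous_im.abs.continuousAt (x := r)).eventually_lt continuousAt_const hr

lemma phi_eq_of_abs_im_lt (hβ : 0 < β) {r : ℂ} (hr : |r.im| < β) (h : theta β r ≠ 0) :
    phi β r = cos (r / 2) / (2 * sin (r / 2)) + thetaProdLogDeriv β r := by
  have hs : sin (r / 2) ≠ 0 := by rw [theta_eq hβ] at h; exact left_ne_zero_of_mul h
  have h1 : HasDerivAt (fun r : ℂ => sin (r / 2)) (cos (r / 2) * (1 / 2)) r :=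
    (Complex.hasDerivAt_sin _).comp r ((hasDerivAt_id r).div_const 2)
  have h2 := h1.mul (hasDerivAt_thetaProd hβ hr)
  have h3 : theta β = fun r => sin (r / 2) * thetaProd β r := funext (theta_eq hβ)
  refine phi_eq_of_hasDerivAt h ?_
  rw [theta_eq hβ, h3]
  refine h2.congr_deriv ?_
  field_simp

lemma hasDerivAt_half_cot {r : ℂ} (h : sin (r / 2) ≠ 0) :
    HasDerivAt (fun r : ℂ => cos (r / 2) / (2 * sin (r / 2))) (-(1 / (4 * sin (r / 2) ^ 2))) r := by
  have h1 : HasDerivAt (fun r : ℂ => sin (r / 2)) (cos (r / 2) * (1 / 2)) r :=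
    (Complex.hasDerivAt_sin _).comp r ((hasDerivAt_id r).div_const 2)
  have h2 : HasDerivAt (fun r : ℂ => cos (r / 2)) (-sin (r / 2) * (1 / 2)) r :=
    (Complex.hasDerivAt_cos _).comp r ((hasDerivAt_id r).div_const 2)
  refine (h2.div (h1.const_mul 2) (by simpa using h)).congr_deriv ?_
  field_simp
  linear_combination -4 * (sin_sq_add_cos_sq (r / 2))

lemma eventually_theta_ne_zero (hβ : 0 < β) {r : ℂ} (h : theta β r ≠ 0) :
    ∀ᶠ s in 𝓝 r, theta β s ≠ 0 :=
  (differentiable_theta hβ).continuous.continuousAt.eventually_ne h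

lemma hasDerivAt_phi_of_abs_im_lt (hβ : 0 < β) {r : ℂ} (hr : |r.im| < β) (h : theta β r ≠ 0) :
    HasDerivAt (phi β) (-V β r) r := by
  have hs : sin (r / 2) ≠ 0 := by rw [theta_eq hβ] at h; exact left_ne_zero_of_mul h
  have h1 := (hasDerivAt_half_cot hs).add (hasDerivAt_thetaProdLogDeriv hβ hr)
  refine (h1.congr_of_eventuallyEq ?_).congr_deriv (by ring)
  filter_upwards [eventually_theta_ne_zero hβ h, eventually_abs_im_lt hr] with s h2 h3
  exact phi_eq_of_abs_im_lt hβ h3 h2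

/-- The formula is known in the strip. It is invariant under `r ↦ r + iβ`, because `φ` changes by
the constant `-i` and `V` not at all. -/
lemma hasDerivAt_phi (hβ : 0 < β) {r : ℂ} (h : theta β r ≠ 0) :
    HasDerivAt (phi β) (-V β r) r := by
  have hper : Function.Periodic
      (fun r => theta β r ≠ 0 → HasDerivAt (phi β) (-V β r) r) (I * β) := fun r => by
    have h1 : theta β (r + I * β) = 0 ↔ theta β r = 0 := iff_of_eq (periodic_theta_eq_zero hβ r)
    simp only [ne_eq, h1, V_add_I_mul, eq_iff_iff]
    refine imp_congr_right fun h0 => ?_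
    have h2 : (fun s => phi β (s + I * β)) =ᶠ[𝓝 r] fun s => phi β s - I := by
      filter_upwards [eventually_theta_ne_zero hβ h0] with s hs using phi_add_I_mul hβ hs
    have h3 : HasDerivAt (phi β) (-V β r) (r + I * β) ↔
        HasDerivAt (fun s => phi β (s + I * β)) (-V β r) r := by
      refine ⟨fun h => h.comp_add_const _ _, fun h => ?_⟩
      have := HasDerivAt.comp_add_const (f := fun s => phi β (s + I * β)) (r + I * β) (-(I * β))
        (by simpa using h)
      simpa using this
    rw [h3, h2.hasDerivAt_iff, hasDerivAt_sub_const_iff]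
  obtain ⟨n, hn⟩ := exists_abs_im_add_lt hβ r
  exact (iff_of_eq (hper.int_mul n r)).1 (hasDerivAt_phi_of_abs_im_lt hβ hn) h

end ThetaLogDeriv

/-! ### Laurent expansions at the origin. -/

section LocalExpansion

variable {β : ℝ}

/-- Writing `sin(r/2) = r s(r)` with `s` even gives `k = s'/s`, hence `k(0) = 0`. The value of
`k'(0)` comes from the Riccati equation of the half cotangent rather than from a Taylor series. -/
lemma exists_half_cot_expansion : ∃ k : ℂ → ℂ, AnalyticAt ℂ k 0 ∧ k 0 = 0 ∧
    deriv k 0 = -(1 / 12) ∧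
    ∀ᶠ r in 𝓝[≠] (0 : ℂ), sin (r / 2) ≠ 0 ∧ cos (r / 2) / (2 * sin (r / 2)) = 1 / r + k r := by
  set f : ℂ → ℂ := fun r => sin (r / 2) with hf
  have hfd (r : ℂ) : HasDerivAt f (cos (r / 2) * (1 / 2)) r :=
    (Complex.hasDerivAt_sin _).comp r ((hasDerivAt_id r).div_const 2)
  set s : ℂ → ℂ := dslope f 0 with hs
  have hsd : Differentiable ℂ s := differentiableOn_univ.1
    ((differentiableOn_dslope univ_mem).2 fun r _ => (hfd r).differentiableAt.differentiableWithinAt)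
  have hmul (r : ℂ) : r * s r = f r := by
    simpa [hf] using sub_smul_dslope f 0 r
  have hs0 : s 0 = 1 / 2 := by rw [hs, dslope_same, (hfd 0).deriv]; simp
  have heven (r : ℂ) : s (-r) = s r := by
    rcases eq_or_ne r 0 with rfl | hr
    · simp
    · have h1 := hmul (-r)
      have h2 := hmul r
      have h3 : f (-r) = -f r := by simp [hf, neg_div]
      refine mul_left_cancel₀ hr ?_
      linear_combination -h1 + -h3 - h2
  have hs' : deriv s 0 = 0 := by
    have h1 := deriv_comp_neg s 0
    simp only [heven, neg_zero] at h1
    linear_combination h1 / 2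
  have hsan : AnalyticAt ℂ s 0 := hsd.analyticAt 0
  set k : ℂ → ℂ := fun r => deriv s r / s r with hk
  have hkan : AnalyticAt ℂ k 0 := hsan.deriv.div hsan (by simp [hs0])
  have hk0 : k 0 = 0 := by simp [hk, hs']
  have hsne : ∀ᶠ r in 𝓝 (0 : ℂ), s r ≠ 0 := hsd.continuous.continuousAt.eventually_ne (by simp [hs0])
  have hcot : ∀ᶠ r in 𝓝[≠] (0 : ℂ),
      sin (r / 2) ≠ 0 ∧ cos (r / 2) / (2 * sin (r / 2)) = 1 / r + k r := by
    filter_upwards [self_mem_nhdsWithin, hsne.filter_mono nhdsWithin_le_nhds] with r hr hsr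
    have hr : r ≠ 0 := hr
    have h1 : sin (r / 2) = r * s r := (hmul r).symm
    have h2 : cos (r / 2) * (1 / 2) = s r + r * deriv s r := by
      have h3 := (hasDerivAt_id r).mul (hsd r).hasDerivAt
      have h4 : id * s = f := funext hmul
      rw [h4] at h3
      simpa using (hfd r).unique h3
    rw [h1, hk]
    refine ⟨mul_ne_zero hr hsr, ?_⟩
    field_simp
    linear_combination 2 * h2
  refine ⟨k, hkan, hk0, ?_, hcot⟩
  -- The Riccati equation `f' = -f² - 1/4` for `f = 1/r + k`. As `r → 0` it becomes `k'(0) = -2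
  -- k'(0) - 1/4`.
  have hderiv : ∀ᶠ r in 𝓝[≠] (0 : ℂ), deriv k r = -(k r) ^ 2 - 2 * (k r / r) - 1 / 4 := by
    have h1 := eventually_eventually_nhdsWithin.2 hcot
    filter_upwards [self_mem_nhdsWithin, hcot, h1] with r hr hr1 hr2
    have hr : r ≠ 0 := hr
    rw [isOpen_compl_singleton.nhdsWithin_eq hr] at hr2
    have h3 : k =ᶠ[𝓝 r] fun r => cos (r / 2) / (2 * sin (r / 2)) - r⁻¹ := by
      filter_upwards [hr2] with t ht
      rw [ht.2]
      ring
    rw [(((hasDerivAt_half_cot hr1.1).sub (hasDerivAt_inv hr)).congr_of_eventuallyEq h3).deriv]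
    have h4 : k r = cos (r / 2) / (2 * sin (r / 2)) - 1 / r := by rw [hr1.2]; ring
    have h5 := hr1.1
    rw [h4]
    field_simp
    linear_combination 4 * r ^ 2 * (sin_sq_add_cos_sq (r / 2))
  have hlim1 : Tendsto (deriv k) (𝓝[≠] 0) (𝓝 (deriv k 0)) :=
    hkan.deriv.continuousAt.tendsto.mono_left nhdsWithin_le_nhds
  have hlim2 : Tendsto (fun r => k r / r) (𝓝[≠] 0) (𝓝 (deriv k 0)) := by
    refine (hasDerivAt_iff_tendsto_slope.1 hkan.differentiableAt.hasDerivAt).congr fun r => ?_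
    simp [slope_def_field, hk0]
  have hlim3 : Tendsto k (𝓝[≠] 0) (𝓝 0) := by
    simpa [hk0] using hkan.continuousAt.tendsto.mono_left (nhdsWithin_le_nhds (s := {0}ᶜ))
  have hlim4 := (((hlim3.pow 2).neg.sub (hlim2.const_mul 2)).sub_const (1 / 4)).congr'
    (hderiv.mono fun r hr => hr.symm)
  have := tendsto_nhds_unique hlim1 hlim4
  linear_combination this / 3

lemma exists_phi_expansion (hβ : 0 < β) : ∃ h : ℂ → ℂ, AnalyticAt ℂ h 0 ∧ h 0 = 0 ∧
    deriv h 0 = -(c0 β : ℂ) ∧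
    ∀ᶠ r in 𝓝[≠] (0 : ℂ), theta β r ≠ 0 ∧ phi β r = 1 / r + h r ∧
      V β r = 1 / r ^ 2 - deriv h r := by
  obtain ⟨k, hkan, hk0, hk', hk⟩ := exists_half_cot_expansion
  have h0 : |(0 : ℂ).im| < β := by simpa
  have hpd : AnalyticAt ℂ (thetaProdLogDeriv β) 0 := by
    rw [analyticAt_iff_eventually_differentiableAt]
    filter_upwards [eventually_abs_im_lt h0] with r hr
    exact (hasDerivAt_thetaProdLogDeriv hβ hr).differentiableAt
  have han := hkan.add hpd
  set h := k + thetaProdLogDeriv β with hh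
  have hexp : ∀ᶠ r in 𝓝[≠] (0 : ℂ), theta β r ≠ 0 ∧ phi β r = 1 / r + h r := by
    filter_upwards [hk, (eventually_abs_im_lt h0).filter_mono nhdsWithin_le_nhds] with r hr1 hr2
    have h1 : theta β r ≠ 0 := by
      rw [theta_eq hβ]; exact mul_ne_zero hr1.1 (thetaProd_ne_zero hβ hr2)
    refine ⟨h1, ?_⟩
    rw [phi_eq_of_abs_im_lt hβ hr2 h1, hr1.2, hh, Pi.add_apply]
    ring
  refine ⟨h, han, by simp [hh, hk0, thetaProdLogDeriv], ?_, ?_⟩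
  -- At `0` the default `1 / 0 = 0` leaves `-1/12 - V β 0`, which is `-c₀`.
  · rw [hh, deriv_add hkan.differentiableAt hpd.differentiableAt, hk',
      (hasDerivAt_thetaProdLogDeriv hβ h0).deriv, c0_eq hβ]
    simp
    ring
  · have h1 := eventually_eventually_nhdsWithin.2 hexp
    have h2 := han.eventually_analyticAt.filter_mono (nhdsWithin_le_nhds (s := {0}ᶜ))
    filter_upwards [self_mem_nhdsWithin, hexp, h1, h2] with r hr hr1 hr2 hr3
    have hr : r ≠ 0 := hr
    rw [isOpen_compl_singleton.nhdsWithin_eq hr] at hr2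
    refine ⟨hr1.1, hr1.2, ?_⟩
    have h3 : phi β =ᶠ[𝓝 r] fun r => r⁻¹ + h r := by
      filter_upwards [hr2] with t ht
      rw [ht.2, one_div]
    have h4 := ((hasDerivAt_inv hr).add hr3.differentiableAt.hasDerivAt).congr_of_eventuallyEq h3
    have h5 := (hasDerivAt_phi hβ hr1.1).unique h4
    rw [one_div]
    linear_combination -h5

lemma isOpen_theta_ne_zero (hβ : 0 < β) : IsOpen {r | theta β r ≠ 0} :=
  isOpen_ne_fun (differentiable_theta hβ).continuous continuous_const

lemma differentiableAt_V (hβ : 0 < β) {r : ℂ} (hr : theta β r ≠ 0) :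
    DifferentiableAt ℂ (V β) r := by
  have h1 : DifferentiableOn ℂ (phi β) {r | theta β r ≠ 0} := fun s hs =>
    (hasDerivAt_phi hβ hs).differentiableAt.differentiableWithinAt
  have h2 := ((h1.deriv (isOpen_theta_ne_zero hβ)).differentiableAt
    ((isOpen_theta_ne_zero hβ).mem_nhds hr)).neg
  refine h2.congr_of_eventuallyEq ?_
  filter_upwards [eventually_theta_ne_zero hβ hr] with s hs
  simp [(hasDerivAt_phi hβ hs).deriv]

/-- The difference of the two sides of the addition formula for `phi`, with `y` fixed. -/
def additionDefect (β : ℝ) (y x : ℂ) : ℂ :=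
  (phi β x + phi β y - phi β (x + y)) ^ 2 - V β x - V β y - V β (x + y) + 3 * c0 β

/-- With `D` the regular part of `φ(x) + φ(y) - φ(x + y)`, the double poles cancel in `(1/x + D)² -
V(x)`. The rest is `2D/x + D² + h'(x) - V(y) - V(x + y) + 3c₀`, whose limit is `2(V(y) - c₀) - c₀ -
2V(y) + 3c₀ = 0`. -/
lemma tendsto_additionDefect (hβ : 0 < β) {y : ℂ} (hy : theta β y ≠ 0) :
    Tendsto (additionDefect β y) (𝓝[≠] 0) (𝓝 0) := by
  obtain ⟨h, han, h0, h', hexp⟩ := exists_phi_expansion hβ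
  set D : ℂ → ℂ := fun x => h x - (phi β (x + y) - phi β y) with hD
  have hDd : HasDerivAt D (-(c0 β : ℂ) + V β y) 0 := by
    have h1 : HasDerivAt (phi β) (-V β y) (0 + y) := by
      rw [zero_add]; exact hasDerivAt_phi hβ hy
    refine ((h' ▸ han.differentiableAt.hasDerivAt).sub
      ((h1.comp_add_const 0 y).sub_const (phi β y))).congr_deriv ?_
    ring
  have hD0 : D 0 = 0 := by simp [hD, h0]
  have hl1 : Tendsto (fun x => D x / x) (𝓝[≠] 0) (𝓝 (-(c0 β : ℂ) + V β y)) := by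
    refine (hasDerivAt_iff_tendsto_slope.1 hDd).congr fun r => ?_
    simp [slope_def_field, hD0]
  have hl2 : Tendsto D (𝓝[≠] 0) (𝓝 0) := by
    simpa [hD0] using hDd.continuousAt.tendsto.mono_left (nhdsWithin_le_nhds (s := {0}ᶜ))
  have hl3 : Tendsto (deriv h) (𝓝[≠] 0) (𝓝 (-(c0 β : ℂ))) :=
    h' ▸ han.deriv.continuousAt.tendsto.mono_left nhdsWithin_le_nhds
  have hl4 : Tendsto (fun x => V β (x + y)) (𝓝[≠] 0) (𝓝 (V β y)) := by
    have h1 : ContinuousAt (V β) (0 + y) := by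
      rw [zero_add]; exact (differentiableAt_V hβ hy).continuousAt
    have h2 : ContinuousAt (fun x => V β (x + y)) 0 :=
      ContinuousAt.comp (f := fun x => x + y) h1 (by fun_prop)
    simpa using h2.tendsto.mono_left (nhdsWithin_le_nhds (s := {0}ᶜ))
  have := ((((hl1.const_mul 2).add (hl2.pow 2)).add hl3).sub_const (V β y) |>.sub hl4).add_const
    (3 * (c0 β : ℂ))
  refine (this.congr' ?_).trans_eq ?_
  · filter_upwards [self_mem_nhdsWithin, hexp] with x hx hx1
    have hx : x ≠ 0 := hx
    rw [additionDefect, hx1.2.1, hx1.2.2, hD]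
    field_simp
    ring
  · congr 1
    ring

end LocalExpansion

/-- A continuous function with periods `2π` and `iβ` that is holomorphic off a countable set is
constant. -/
lemma eq_of_doublyPeriodic {β : ℝ} (hβ : 0 < β) {f : ℂ → ℂ} (hc : Continuous f) {s : Set ℂ}
    (hs : s.Countable) (hd : ∀ z ∉ s, DifferentiableAt ℂ f z)
    (h1 : Function.Periodic f (2 * Real.pi)) (h2 : Function.Periodic f (I * β)) (z w : ℂ) :
    f z = f w := by
  -- A continuous function that is holomorphic off a countable set is holomorphic, so no separate
  -- analysis of the singularities is needed.
  have hdiff : Differentiable ℂ f := fun z =>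
    (hasFPowerSeriesOnBall_of_differentiable_off_countable (R := 1) hs hc.continuousOn
      (c := z) (fun w hw => hd w hw.2) one_pos).analyticAt.differentiableAt
  -- Liouville: all values are already taken on a compact period rectangle.
  refine hdiff.apply_eq_apply_of_bounded ?_ z w
  have hK : IsCompact (f '' (Icc 0 (2 * Real.pi) ×ℂ Icc 0 β)) :=
    (isCompact_Icc.reProdIm isCompact_Icc).image hc
  refine hK.isBounded.subset ?_
  rintro _ ⟨z, rfl⟩
  have hpi : 0 < 2 * Real.pi := by positivity
  obtain ⟨m, hm, -⟩ := existsUnique_add_zsmul_mem_Ico hpi z.re 0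
  obtain ⟨n, hn, -⟩ := existsUnique_add_zsmul_mem_Ico hβ z.im 0
  refine ⟨z + m * (2 * Real.pi) + n * (I * β), ?_, ?_⟩
  · rw [Complex.mem_reProdIm]
    simp only [zsmul_eq_mul, zero_add] at hm hn
    constructor
    · simpa using Ico_subset_Icc_self hm
    · simpa using Ico_subset_Icc_self hn
  · rw [h2.int_mul n, h1.int_mul m]

/-! ### The addition formula for `φ`. -/

section Addition

variable {β : ℝ}

lemma additionDefect_add_two_pi (hβ : 0 < β) (y x : ℂ) :
    additionDefect β y (x + 2 * Real.pi) = additionDefect β y x := by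
  rw [additionDefect, additionDefect, add_right_comm x, phi_add_two_pi hβ, phi_add_two_pi hβ,
    V_add_two_pi, V_add_two_pi]

lemma additionDefect_add_I_mul (hβ : 0 < β) {y x : ℂ} (hx : theta β x ≠ 0)
    (hxy : theta β (x + y) ≠ 0) :
    additionDefect β y (x + I * β) = additionDefect β y x := by
  rw [additionDefect, additionDefect, add_right_comm x, phi_add_I_mul hβ hx, phi_add_I_mul hβ hxy,
    V_add_I_mul, V_add_I_mul]
  ring

/-- By oddness, `x ↦ -x - y` exchanges `φ(x)` and `-φ(x + y)`. This carries the singularity at `x =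
-y` to the one at `0`. -/
lemma additionDefect_neg_sub (hβ : 0 < β) (y x : ℂ) :
    additionDefect β y (-x - y) = additionDefect β y x := by
  rw [additionDefect, additionDefect, sub_add_cancel, show -x - y = -(x + y) by ring, phi_neg hβ,
    phi_neg hβ, V_neg, V_neg]
  ring

open Classical in
/-- `additionDefect β y`, with the removable singularities removed. -/
def additionDefectExt (β : ℝ) (y x : ℂ) : ℂ :=
  if theta β x = 0 ∨ theta β (x + y) = 0 then 0 else additionDefect β y x

lemma additionDefectExt_periodic_two_pi (hβ : 0 < β) (y : ℂ) :
    Function.Periodic (additionDefectExt β y) (2 * Real.pi) := fun x => by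
  simp only [additionDefectExt, add_right_comm x (2 * (Real.pi : ℂ)) y,
    additionDefect_add_two_pi hβ, theta_add_two_pi hβ, neg_eq_zero]

lemma additionDefectExt_periodic_I_mul (hβ : 0 < β) (y : ℂ) :
    Function.Periodic (additionDefectExt β y) (I * β) := fun x => by
  have h1 (r : ℂ) : theta β (r + I * β) = 0 ↔ theta β r = 0 := iff_of_eq (periodic_theta_eq_zero hβ r)
  simp only [additionDefectExt, add_right_comm x (I * β) y, h1]
  split_ifs with h
  · rfl
  · push Not at h
    exact additionDefect_add_I_mul hβ h.1 h.2

lemma additionDefectExt_neg_sub (hβ : 0 < β) (y x : ℂ) :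
    additionDefectExt β y (-x - y) = additionDefectExt β y x := by
  have h : theta β (-x - y) = 0 ↔ theta β (x + y) = 0 := by
    rw [show -x - y = -(x + y) by ring, theta_neg hβ, neg_eq_zero]
  simp only [additionDefectExt, additionDefect_neg_sub hβ, sub_add_cancel, theta_neg hβ, h,
    neg_eq_zero, or_comm]

lemma differentiableAt_additionDefect (hβ : 0 < β) {y x : ℂ} (hx : theta β x ≠ 0)
    (hxy : theta β (x + y) ≠ 0) : DifferentiableAt ℂ (additionDefect β y) x := by
  have h1 := (hasDerivAt_phi hβ hx).differentiableAt
  have h2 := ((hasDerivAt_phi hβ hxy).comp_add_const x y).differentiableAt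
  have h3 := differentiableAt_V hβ hx
  have h4 : DifferentiableAt ℂ (fun x => V β (x + y)) x :=
    differentiableAt_comp_add_const.2 (differentiableAt_V hβ hxy)
  exact ((((((h1.add_const _).sub h2).pow 2).sub h3).sub_const _).sub h4).add_const _

lemma differentiableAt_additionDefectExt (hβ : 0 < β) {y x : ℂ} (hx : theta β x ≠ 0)
    (hxy : theta β (x + y) ≠ 0) : DifferentiableAt ℂ (additionDefectExt β y) x := by
  refine (differentiableAt_additionDefect hβ hx hxy).congr_of_eventuallyEq ?_
  have h : ∀ᶠ z in 𝓝 x, theta β (z + y) ≠ 0 :=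
    (by fun_prop : ContinuousAt (fun z => z + y) x).eventually (eventually_theta_ne_zero hβ hxy)
  filter_upwards [eventually_theta_ne_zero hβ hx, h] with z h1 h2
  simp [additionDefectExt, h1, h2]

lemma continuousAt_additionDefectExt_zero (hβ : 0 < β) {y : ℂ} (hy : theta β y ≠ 0) :
    ContinuousAt (additionDefectExt β y) 0 := by
  rw [continuousAt_iff_punctured_nhds]
  have h0 : additionDefectExt β y 0 = 0 := by simp [additionDefectExt, theta_zero hβ]
  rw [h0]
  refine (tendsto_additionDefect hβ hy).congr' ?_
  obtain ⟨h, -, -, -, hexp⟩ := exists_phi_expansion hβ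
  have h2 : ∀ᶠ z in 𝓝 (0 : ℂ), theta β (z + y) ≠ 0 :=
    (by fun_prop : ContinuousAt (fun z => z + y) 0).eventually
      (eventually_theta_ne_zero hβ (by simpa using hy))
  filter_upwards [hexp, h2.filter_mono nhdsWithin_le_nhds] with z h1 h2
  simp [additionDefectExt, h1.1, h2]

lemma continuousAt_additionDefectExt_of_theta_eq_zero (hβ : 0 < β) {y x : ℂ} (hy : theta β y ≠ 0)
    (hx : theta β x = 0) : ContinuousAt (additionDefectExt β y) x := by
  obtain ⟨a, b, rfl⟩ := (theta_eq_zero_iff hβ).1 hx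
  set c : ℂ := 2 * Real.pi * a + I * β * b with hc
  have hper : additionDefectExt β y = fun z => additionDefectExt β y (z - c) := by
    ext z
    rw [← (additionDefectExt_periodic_two_pi hβ y).int_mul a (z - c),
      ← (additionDefectExt_periodic_I_mul hβ y).int_mul b (z - c + _), hc]
    congr 1
    ring
  rw [hper]
  have h0 : ContinuousAt (additionDefectExt β y) (c - c) := by
    rw [sub_self]; exact continuousAt_additionDefectExt_zero hβ hy
  exact ContinuousAt.comp (f := fun z => z - c) h0 (by fun_prop)

lemma continuous_additionDefectExt (hβ : 0 < β) {y : ℂ} (hy : theta β y ≠ 0) :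
    Continuous (additionDefectExt β y) := by
  rw [continuous_iff_continuousAt]
  intro x
  by_cases hx : theta β x = 0
  · exact continuousAt_additionDefectExt_of_theta_eq_zero hβ hy hx
  by_cases hxy : theta β (x + y) = 0
  · have h0 : ContinuousAt (additionDefectExt β y) (-x - y) :=
      continuousAt_additionDefectExt_of_theta_eq_zero hβ hy (by
        rw [show -x - y = -(x + y) by ring, theta_neg hβ, hxy, neg_zero])
    have h1 := ContinuousAt.comp (f := fun z => -z - y) h0 (by fun_prop)
    exact h1.congr (.of_forall fun z => additionDefectExt_neg_sub hβ y z)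
  · exact (differentiableAt_additionDefectExt hβ hx hxy).continuousAt

lemma countable_theta_eq_zero (hβ : 0 < β) : {r | theta β r = 0}.Countable := by
  refine (countable_range fun p : ℤ × ℤ => (2 * Real.pi * p.1 + I * β * p.2 : ℂ)).mono ?_
  intro r hr
  obtain ⟨a, b, rfl⟩ := (theta_eq_zero_iff hβ).1 hr
  exact ⟨(a, b), rfl⟩

/-- The addition formula
`(φ(x) + φ(y) - φ(x + y)) ^ 2 = V(x) + V(y) + V(x + y) - 3 c₀`. -/
theorem phi_addition (hβ : 0 < β) {x y : ℂ} (hx : theta β x ≠ 0) (hy : theta β y ≠ 0)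
    (hxy : theta β (x + y) ≠ 0) :
    (phi β x + phi β y - phi β (x + y)) ^ 2 =
      V β x + V β y + V β (x + y) - 3 * c0 β := by
  have hs : ({r | theta β r = 0} ∪ (fun r => r + y) ⁻¹' {r | theta β r = 0}).Countable :=
    (countable_theta_eq_zero hβ).union
      ((countable_theta_eq_zero hβ).preimage (add_left_injective y))
  -- Comparison with the point `0`, where the extension has the value `0`.
  have h := eq_of_doublyPeriodic hβ (continuous_additionDefectExt hβ hy) hs
    (fun z hz => by
      simp only [mem_union, mem_ofPred_eq, mem_preimage, not_or] at hz
      exact differentiableAt_additionDefectExt hβ hz.1 hz.2)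
    (additionDefectExt_periodic_two_pi hβ y) (additionDefectExt_periodic_I_mul hβ y) x 0
  simp only [additionDefectExt, hx, hxy, theta_zero hβ, or_self, if_false, true_or, if_true,
    additionDefect] at h
  linear_combination h

end Addition

/-! ### Reduction of three-body sums for neutral charges. -/

section Algebra

variable {ι : Type*} [Fintype ι]

lemma sum_sum_sum_rotate (F : ι → ι → ι → ℂ) :
    ∑ a, ∑ b, ∑ c, F b c a = ∑ a, ∑ b, ∑ c, F a b c := by
  rw [Finset.sum_comm]
  exact Finset.sum_congr rfl fun b _ => Finset.sum_comm

/-- Three times either sum is the sum of its cyclic symmetrization. -/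
lemma sum_sum_sum_eq_of_rotate (F G : ι → ι → ι → ℂ)
    (h : ∀ a b c, F a b c + F b c a + F c a b = G a b c + G b c a + G c a b) :
    ∑ a, ∑ b, ∑ c, F a b c = ∑ a, ∑ b, ∑ c, G a b c := by
  have key (F : ι → ι → ι → ℂ) : 3 * ∑ a, ∑ b, ∑ c, F a b c =
      ∑ a, ∑ b, ∑ c, (F a b c + F b c a + F c a b) := by
    have h1 := sum_sum_sum_rotate F
    have h2 := sum_sum_sum_rotate fun a b c => F b c a
    simp only [Finset.sum_add_distrib]
    linear_combination -2 * h1 - h2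
  have h3 := key F
  simp only [h, ← key] at h3
  exact mul_left_cancel₀ three_ne_zero h3

/-- For charges of total zero, the three-body terms of a sum of squares of pair functions
satisfying the addition formula reduce to two-body terms. -/
lemma sum_mul_sq_sum_eq [DecidableEq ι] (M : ι → ℂ) (hM : ∑ a, M a = 0) (A B : ι → ι → ℂ) (c : ℂ)
    (hA : ∀ a b, A b a = -A a b) (hB : ∀ a b, B b a = B a b) (hB0 : ∀ a, B a a = 0)
    (hAB : ∀ a b d, a ≠ b → b ≠ d → d ≠ a →
      (A a b + A b d + A d a) ^ 2 = B a b + B b d + B d a - 3 * c) :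
    ∑ a, M a * (∑ b, M b * A a b) ^ 2 =
      ∑ a, ∑ b, M a ^ 2 * M b * B a b + c * ∑ a, M a ^ 3 := by
  have hA0 (a : ι) : A a a = 0 := by linear_combination hA a a / 2
  have h1 : ∑ a, M a * (∑ b, M b * A a b) ^ 2 =
      ∑ a, ∑ b, ∑ d, M a * M b * M d * (A a b * A a d) := by
    refine Finset.sum_congr rfl fun a _ => ?_
    rw [sq, Finset.sum_mul_sum, Finset.mul_sum]
    refine Finset.sum_congr rfl fun b _ => ?_
    rw [Finset.mul_sum]
    exact Finset.sum_congr rfl fun d _ => by ring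
  -- For distinct indices the addition formula expresses the cyclic sum of `A a b * A a d` by `-(B -
  -- A² - c)/2` over the three pairs. The Kronecker terms are the corrections that keep this
  -- identity true when two or all three indices coincide.
  have h2 := sum_sum_sum_eq_of_rotate (fun a b d => M a * M b * M d * (A a b * A a d))
    (fun a b d => M a * M b * M d * (-(1 / 2) * (B a b - A a b ^ 2 - c)
      + (if a = b then B b d - 3 * c / 2 else 0) + (if a = b then if b = d then c else 0 else 0)))
    (fun a b d => by
      have e : A a b * A a d + A b d * A b a + A d a * A d b =
          (-(1 / 2) * (B a b - A a b ^ 2 - c)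
            + (if a = b then B b d - 3 * c / 2 else 0)
            + (if a = b then if b = d then c else 0 else 0))
          + (-(1 / 2) * (B b d - A b d ^ 2 - c)
            + (if b = d then B d a - 3 * c / 2 else 0)
            + (if b = d then if d = a then c else 0 else 0))
          + (-(1 / 2) * (B d a - A d a ^ 2 - c)
            + (if d = a then B a b - 3 * c / 2 else 0)
            + (if d = a then if a = b then c else 0 else 0)) := by
        by_cases hab : a = b
        · subst hab
          by_cases had : a = d
          · subst had
            simp only [if_true, hA0, hB0]
            ring
          · simp only [if_true, if_neg had, if_neg (Ne.symm had), hA0, hB0]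
            rw [hB a d, hA a d]
            ring
        · by_cases hbd : b = d
          · subst hbd
            simp only [if_true, if_neg hab, if_neg (Ne.symm hab), hA0, hB0]
            rw [hB a b, hA a b]
            ring
          · by_cases hda : d = a
            · subst hda
              simp only [if_true, if_neg hab, if_neg hbd, hA0, hB0]
              rw [hB d b, hA d b]
              ring
            · simp only [if_neg hab, if_neg hbd, if_neg hda]
              have h := hAB a b d hab hbd hda
              rw [hA d a, hA a b, hA b d]
              linear_combination -h / 2
      linear_combination M a * M b * M d * e)
  rw [h1, h2]
  -- The summand contains `d` only through `M d`, so neutrality removes it together with `A²`.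
  have h3 (a b : ι) : ∑ d, M a * M b * M d * (-(1 / 2) * (B a b - A a b ^ 2 - c)) = 0 := by
    rw [← Finset.sum_mul, ← Finset.mul_sum, hM]
    ring
  have h4 (a : ι) : ∑ b, ∑ d, M a * M b * M d * (if a = b then B b d - 3 * c / 2 else 0) =
      ∑ b, M a ^ 2 * M b * B a b := by
    rw [Finset.sum_eq_single a (fun b _ hb => by simp [hb.symm]) (by simp)]
    simp only [if_true]
    have : ∑ d, M a * M a * M d * (3 * c / 2) = 0 := by
      rw [← Finset.sum_mul, ← Finset.mul_sum, hM]; ring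
    rw [← sub_zero (∑ b, M a ^ 2 * M b * B a b), ← this, ← Finset.sum_sub_distrib]
    exact Finset.sum_congr rfl fun d _ => by ring
  have h5 (a : ι) : ∑ b, ∑ d, M a * M b * M d *
      (if a = b then if b = d then c else 0 else 0) = c * M a ^ 3 := by
    rw [Finset.sum_eq_single a (fun b _ hb => by simp [hb.symm]) (by simp),
      Finset.sum_eq_single a (fun b _ hb => by simp [hb.symm]) (by simp)]
    simp only [if_true]
    ring
  simp only [mul_add, Finset.sum_add_distrib, h3, h4, h5, zero_add, Finset.mul_sum]

lemma sum_Ioi_eq_half {n : ℕ} (G : Fin n → Fin n → ℂ) (hG : ∀ j k, G k j = G j k) :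
    ∑ j, ∑ k ∈ Finset.Ioi j, G j k = (1 / 2) * ∑ j, ∑ k, if j = k then 0 else G j k := by
  have h1 : ∑ j, ∑ k ∈ Finset.Ioi j, G j k = ∑ j, ∑ k, if j < k then G j k else 0 := by
    refine Finset.sum_congr rfl fun j _ => ?_
    rw [← Finset.sum_filter]
    exact Finset.sum_congr (by ext; simp) fun _ _ => rfl
  have h2 : ∑ j, ∑ k, (if j < k then G j k else 0) = ∑ j, ∑ k, if k < j then G j k else 0 := by
    rw [Finset.sum_comm]
    exact Finset.sum_congr rfl fun j _ => Finset.sum_congr rfl fun k _ => by rw [hG]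
  have h3 : ∑ j, ∑ k, (if j = k then 0 else G j k) =
      ∑ j, ∑ k, (if j < k then G j k else 0) + ∑ j, ∑ k, if k < j then G j k else 0 := by
    simp only [← Finset.sum_add_distrib]
    refine Finset.sum_congr rfl fun j _ => Finset.sum_congr rfl fun k _ => ?_
    rcases lt_trichotomy j k with h | h | h
    · simp [h, h.ne, h.not_gt]
    · simp [h]
    · simp [h, h.ne', h.not_gt]
  rw [h1, h3, ← h2]
  ring

end Algebra

/-! ### Derivatives of products in logarithmic form. -/

section LogDerivative

variable {𝕜 : Type} [NontriviallyNormedField 𝕜] [NormedAlgebra 𝕜 ℂ]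

lemma hasDerivAt_mul_of_logDeriv {f g : 𝕜 → ℂ} {l m : ℂ} {t : 𝕜} (hf : HasDerivAt f (f t * l) t)
    (hg : HasDerivAt g (g t * m) t) :
    HasDerivAt (fun s => f s * g s) (f t * g t * (l + m)) t :=
  (hf.mul hg).congr_deriv (by ring)

lemma hasDerivAt_div_of_logDeriv {f g : 𝕜 → ℂ} {l m : ℂ} {t : 𝕜} (hf : HasDerivAt f (f t * l) t)
    (hg : HasDerivAt g (g t * m) t) (h0 : g t ≠ 0) :
    HasDerivAt (fun s => f s / g s) (f t / g t * (l - m)) t :=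
  (hf.div hg h0).congr_deriv (by field_simp)

lemma hasDerivAt_prod_of_logDeriv {κ : Type*} (s : Finset κ) {f : κ → 𝕜 → ℂ} {l : κ → ℂ} {t : 𝕜}
    (hf : ∀ i ∈ s, HasDerivAt (f i) (f i t * l i) t) :
    HasDerivAt (fun t => ∏ i ∈ s, f i t) ((∏ i ∈ s, f i t) * ∑ i ∈ s, l i) t := by
  classical
  induction s using Finset.induction_on with
  | empty => simpa using hasDerivAt_const t (1 : ℂ)
  | insert i s hi ih =>
    simp only [Finset.prod_insert hi, Finset.sum_insert hi]
    exact hasDerivAt_mul_of_logDeriv (hf i (Finset.mem_insert_self i s))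
      (ih fun j hj => hf j (Finset.mem_insert_of_mem hj))

end LogDerivative

/-! ### Both groups of variables as one family. -/

section Variables

variable {𝕜 : Type} {N N' : ℕ}

/-- The variables `(x, x̃)` as one family. -/
def coord (p : Config 𝕜 N N') : Fin N ⊕ Fin N' → 𝕜 := Sum.elim p.1 p.2

/-- Replace the variable with index `a` by `t`. -/
def setCoord (p : Config 𝕜 N N') (a : Fin N ⊕ Fin N') (t : 𝕜) : Config 𝕜 N N' :=
  match a with
  | .inl i => (Function.update p.1 i t, p.2)
  | .inr i => (p.1, Function.update p.2 i t)

lemma coord_setCoord (p : Config 𝕜 N N') (a b : Fin N ⊕ Fin N') (t : 𝕜) :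
    coord (setCoord p a t) b = if a = b then t else coord p b := by
  rcases a with i | i <;> rcases b with j | j <;>
    simp [coord, setCoord, Function.update_apply, eq_comm]

lemma setCoord_coord (p : Config 𝕜 N N') (a : Fin N ⊕ Fin N') :
    setCoord p a (coord p a) = p := by
  rcases a with i | i <;> simp [coord, setCoord]

variable [NontriviallyNormedField 𝕜]

lemma continuous_setCoord (p : Config 𝕜 N N') (a : Fin N ⊕ Fin N') :
    Continuous (setCoord p a) := by
  rcases a with i | i
  · exact ((continuous_const (y := p.1)).update i continuous_id).prodMk continuous_const
  · exact continuous_const.prodMk ((continuous_const (y := p.2)).update i continuous_id)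

lemma contDiff_coord (b : Fin N ⊕ Fin N') :
    ContDiff 𝕜 2 fun p : Config 𝕜 N N' => coord p b := by
  rcases b with j | j
  · exact (contDiff_apply 𝕜 𝕜 j).comp contDiff_fst
  · exact (contDiff_apply 𝕜 𝕜 j).comp contDiff_snd

variable [NormedAlgebra 𝕜 ℂ]

/-- The difference of two of the variables, as a complex number. -/
def coordSub (p : Config 𝕜 N N') (b c : Fin N ⊕ Fin N') : ℂ :=
  algebraMap 𝕜 ℂ (coord p b - coord p c)

lemma coordSub_self (p : Config 𝕜 N N') (b : Fin N ⊕ Fin N') : coordSub p b b = 0 := by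
  simp [coordSub]

lemma coordSub_swap (p : Config 𝕜 N N') (b c : Fin N ⊕ Fin N') :
    coordSub p c b = -coordSub p b c := by
  simp [coordSub]

lemma coordSub_add (p : Config 𝕜 N N') (b c d : Fin N ⊕ Fin N') :
    coordSub p b c + coordSub p c d = coordSub p b d := by
  simp [coordSub]

lemma contDiff_coordSub (b c : Fin N ⊕ Fin N') :
    ContDiff 𝕜 2 fun p : Config 𝕜 N N' => coordSub p b c :=
  (algebraMapCLM 𝕜 ℂ).contDiff.comp ((contDiff_coord b).sub (contDiff_coord c))

lemma hasDerivAt_coord_setCoord (p : Config 𝕜 N N') (a b : Fin N ⊕ Fin N') (t : 𝕜) :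
    HasDerivAt (fun s => algebraMap 𝕜 ℂ (coord (setCoord p a s) b)) (if a = b then 1 else 0) t := by
  simp only [coord_setCoord]
  split_ifs with h
  · exact ((algebraMapCLM 𝕜 ℂ).hasDerivAt (x := t)).congr_deriv (by simp)
  · exact hasDerivAt_const _ _

lemma hasDerivAt_coordSub_setCoord (p : Config 𝕜 N N') (a b c : Fin N ⊕ Fin N') (t : 𝕜) :
    HasDerivAt (fun s => coordSub (setCoord p a s) b c)
      ((if a = b then 1 else 0) - (if a = c then 1 else 0)) t := by
  simp only [coordSub, map_sub]
  exact (hasDerivAt_coord_setCoord p a b t).sub (hasDerivAt_coord_setCoord p a c t)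

lemma theta_coordSub_ne_zero {β : ℝ} (hβ : 0 < β) {p : Config 𝕜 N N'}
    (hp : p ∈ regularConfig 𝕜 N N' β) {b c : Fin N ⊕ Fin N'} (hbc : b ≠ c) :
    theta β (coordSub p b c) ≠ 0 := by
  obtain ⟨h1, h2, h3⟩ := hp
  rcases b with j | j <;> rcases c with k | k
  · exact (offLattice_iff hβ).1 (h1 j k (by simpa using hbc))
  · exact (offLattice_iff hβ).1 (h3 j k)
  · rw [coordSub_swap, theta_neg hβ, neg_ne_zero]
    exact (offLattice_iff hβ).1 (h3 k j)
  · exact (offLattice_iff hβ).1 (h2 j k (by simpa using hbc))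

end Variables

/-! ### Branches of the powers of `θ`. -/

section PairFactor

variable {𝕜 : Type} [NontriviallyNormedField 𝕜] [NormedAlgebra 𝕜 ℂ] {N N' : ℕ} {β : ℝ}

/-- On `D`, the function `f` is non-zero and locally an analytic function of the difference
`r` of the variables `b` and `c`, with logarithmic derivative `g φ(r)`: a branch of
`θ(r) ^ g` up to a locally constant factor. -/
def IsPairFactor (β : ℝ) (D : Set (Config 𝕜 N N')) (b c : Fin N ⊕ Fin N') (g : ℂ)
    (f : Config 𝕜 N N' → ℂ) : Prop :=
  ∀ q ∈ D, f q ≠ 0 ∧ ∃ F : ℂ → ℂ, AnalyticAt ℂ F (coordSub q b c) ∧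
    HasDerivAt F (f q * (g * phi β (coordSub q b c))) (coordSub q b c) ∧
    f =ᶠ[𝓝 q] fun p => F (coordSub p b c)

variable {D : Set (Config 𝕜 N N')} {b c : Fin N ⊕ Fin N'} {g : ℂ} {f : Config 𝕜 N N' → ℂ}

lemma IsPairFactor.contDiffAt (h : IsPairFactor β D b c g f) {q : Config 𝕜 N N'} (hq : q ∈ D) :
    ContDiffAt 𝕜 2 f q := by
  obtain ⟨-, F, hF, -, hf⟩ := h q hq
  have h1 : ContDiffAt ℂ 2 F (coordSub q b c) := hF.contDiffAt
  exact ((h1.restrict_scalars 𝕜).comp q (contDiff_coordSub b c).contDiffAt).congr_of_eventuallyEq hf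

lemma IsPairFactor.hasDerivAt (h : IsPairFactor β D b c g f) (p : Config 𝕜 N N')
    (a : Fin N ⊕ Fin N') {t : 𝕜} (ht : setCoord p a t ∈ D) :
    HasDerivAt (fun s => f (setCoord p a s)) (f (setCoord p a t) *
      (g * phi β (coordSub (setCoord p a t) b c) *
        ((if a = b then 1 else 0) - (if a = c then 1 else 0)))) t := by
  obtain ⟨-, F, -, hF, hf⟩ := h _ ht
  have h1 := hF.comp t (hasDerivAt_coordSub_setCoord p a b c t)
  refine (h1.congr_of_eventuallyEq ?_).congr_deriv (by ring)
  exact (continuous_setCoord p a).continuousAt.eventually hf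

lemma isPairFactor_theta (hβ : 0 < β) (hD : D ⊆ regularConfig 𝕜 N N' β) (hbc : b ≠ c) :
    IsPairFactor β D b c 1 fun p => theta β (coordSub p b c) := fun q hq => by
  have h0 := theta_coordSub_ne_zero hβ (hD hq) hbc
  refine ⟨h0, theta β, (differentiable_theta hβ).analyticAt _, ?_, .rfl⟩
  rw [one_mul]
  exact hasDerivAt_theta hβ h0

/-- A continuous logarithm differs from the principal logarithm of the quotient by a constant. -/
lemma eventually_eq_add_log {E : Type*} [TopologicalSpace E] {L w : E → ℂ} {q : E}
    (hL : ContinuousAt L q) (hw : ∀ᶠ p in 𝓝 q, cexp (L p) = w p) :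
    ∀ᶠ p in 𝓝 q, L p = L q + log (w p / w q) := by
  have h1 : ∀ᶠ p in 𝓝 q, |(L p - L q).im| < Real.pi := by
    have : ContinuousAt (fun p => |(L p - L q).im|) q :=
      (continuous_abs.comp continuous_im).continuousAt.comp (hL.sub_const (L q))
    exact this.eventually_lt continuousAt_const (by simpa using Real.pi_pos)
  filter_upwards [h1, hw] with p hp hwp
  rw [← hwp, ← hw.self_of_nhds, ← Complex.exp_sub, Complex.log_exp (abs_lt.1 hp).1 (abs_lt.1 hp).2.le]
  ring

lemma isPairFactor_exp (hβ : 0 < β) (hDo : IsOpen D) (hD : D ⊆ regularConfig 𝕜 N N' β)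
    (hbc : b ≠ c) {L : Config 𝕜 N N' → ℂ} (hL : ContinuousOn L D)
    (hexp : ∀ p ∈ D, cexp (L p) = theta β (coordSub p b c))
    (hf : ∀ p ∈ D, f p = cexp (g * L p)) : IsPairFactor β D b c g f := fun q hq => by
  have h0 := theta_coordSub_ne_zero hβ (hD hq) hbc
  set r := coordSub q b c with hr
  have hDq := hDo.mem_nhds hq
  refine ⟨by rw [hf q hq]; exact exp_ne_zero _,
    -- Near `q` the given logarithm equals `L q` plus the principal logarithm of `θ(s)/θ(r)`, which
    -- is analytic because the quotient is near `1`.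
    fun s => cexp (g * (L q + log (theta β s / theta β r))), ?_, ?_, ?_⟩
  · have h1 : AnalyticAt ℂ (fun s => theta β s / theta β r) r :=
      ((differentiable_theta hβ).analyticAt r).div_const
    have h2 := h1.clog (by simp [div_self h0])
    exact (analyticAt_const.mul (analyticAt_const.add h2)).cexp
  · have h1 := ((hasDerivAt_theta hβ h0).div_const (theta β r)).clog (by simp [div_self h0])
    refine ((h1.const_add (L q)).const_mul g).cexp.congr_deriv ?_
    rw [hf q hq, div_self h0, log_one, add_zero, div_one, mul_div_cancel_left₀ _ h0]
  · filter_upwards [eventually_eq_add_log (hL.continuousAt hDq)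
      (eventually_of_mem hDq hexp), hDq] with p hp hpD
    rw [hf p hpD, hp]

end PairFactor

/-! ### The ground state and the eigenvalue equation. -/

section GroundState

variable {𝕜 : Type} [NontriviallyNormedField 𝕜] [NormedAlgebra 𝕜 ℂ] {N N' : ℕ} {β : ℝ} {lam : ℂ}

/-- The product of pair factors `W j k` for `θ(x_j - x_k) ^ lam` and `W' J K` for
`θ(x̃_J - x̃_K) ^ (1 / lam)`, divided by the `θ(x_j - x̃_K)`. -/
def pairProduct (β : ℝ) (W : Fin N → Fin N → Config 𝕜 N N' → ℂ)
    (W' : Fin N' → Fin N' → Config 𝕜 N N' → ℂ) (p : Config 𝕜 N N') : ℂ :=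
  (∏ j : Fin N, ∏ k ∈ Finset.Ioi j, W j k p) *
    (∏ J : Fin N', ∏ K ∈ Finset.Ioi J, W' J K p) /
    ∏ j : Fin N, ∏ K : Fin N', theta β (coordSub p (.inl j) (.inr K))

/-- The charges: `1` for the variables `x`, and `-1 / lam` for the variables `x̃`. -/
def charge (N N' : ℕ) (lam : ℂ) : Fin N ⊕ Fin N' → ℂ := Sum.elim (fun _ => 1) fun _ => -1 / lam

/-- The logarithmic derivative of the ground state with respect to the variable `a`. -/
def logGrad (β : ℝ) (lam : ℂ) (p : Config 𝕜 N N') (a : Fin N ⊕ Fin N') : ℂ :=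
  lam * charge N N' lam a * ∑ b, charge N N' lam b * phi β (coordSub p a b)

/-- The pair potential `V`, with zero on the diagonal. -/
def pairV (β : ℝ) (p : Config 𝕜 N N') (a b : Fin N ⊕ Fin N') : ℂ :=
  if a = b then 0 else V β (coordSub p a b)

/-- Oddness of `φ` makes each summand symmetric in its pair, so sums over `j < k` are half of full
sums, and the indicators of `a` collapse one index. -/
lemma logGrad_eq_sum (hβ : 0 < β) (hlam : lam ≠ 0) (p : Config 𝕜 N N') (a : Fin N ⊕ Fin N') :
    (∑ j : Fin N, ∑ k ∈ Finset.Ioi j, lam * phi β (coordSub p (.inl j) (.inl k)) *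
        ((if a = .inl j then 1 else 0) - (if a = .inl k then 1 else 0)))
      + (∑ J : Fin N', ∑ K ∈ Finset.Ioi J, 1 / lam * phi β (coordSub p (.inr J) (.inr K)) *
        ((if a = .inr J then 1 else 0) - (if a = .inr K then 1 else 0)))
      - (∑ j : Fin N, ∑ K : Fin N', 1 * phi β (coordSub p (.inl j) (.inr K)) *
        ((if a = .inl j then 1 else 0) - (if a = .inr K then 1 else 0))) =
    logGrad β lam p a := by
  have hphi (b c : Fin N ⊕ Fin N') : phi β (coordSub p c b) = -phi β (coordSub p b c) := by
    rw [coordSub_swap, phi_neg hβ]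
  rw [sum_Ioi_eq_half _ fun j k => by rw [hphi]; ring,
    sum_Ioi_eq_half _ fun j k => by rw [hphi]; ring]
  have hdiag {n : ℕ} (G : Fin n → Fin n → ℂ) (hG : ∀ j, G j j = 0) :
      ∑ j, ∑ k, (if j = k then 0 else G j k) = ∑ j, ∑ k, G j k := by
    refine Finset.sum_congr rfl fun j _ => Finset.sum_congr rfl fun k _ => ?_
    split_ifs with h
    · rw [← h, hG]
    · rfl
  rw [hdiag _ fun j => by simp, hdiag _ fun j => by simp]
  have hleft {n m : ℕ} (i : Fin n) (G : Fin n → Fin m → ℂ) :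
      ∑ j, ∑ k, (if i = j then G j k else 0) = ∑ k, G i k := by
    rw [Finset.sum_comm]; simp
  have hright {n m : ℕ} (i : Fin m) (G : Fin n → Fin m → ℂ) :
      ∑ j, ∑ k, (if i = k then G j k else 0) = ∑ j, G j i := by
    simp
  rcases a with i | i
  · simp only [Sum.inl.injEq, reduceCtorEq, if_false, sub_zero, mul_zero, Finset.sum_const_zero,
      mul_sub, Finset.sum_sub_distrib, logGrad, charge, Fintype.sum_sum_type, Sum.elim_inl,
      Sum.elim_inr, mul_ite, mul_one, add_zero, hleft, hright, hphi (.inl i), ← Finset.mul_sum,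
      Finset.sum_neg_distrib]
    field_simp
    ring
  · simp only [Sum.inr.injEq, reduceCtorEq, if_false, sub_zero, mul_zero, Finset.sum_const_zero,
      mul_sub, Finset.sum_sub_distrib, logGrad, charge, Fintype.sum_sum_type, Sum.elim_inl,
      Sum.elim_inr, mul_ite, mul_one, zero_add, hleft, hright, hphi (.inr i), ← Finset.mul_sum,
      Finset.sum_neg_distrib]
    field_simp
    ring

lemma hasDerivAt_pairProduct (hβ : 0 < β) (hlam : lam ≠ 0) {D : Set (Config 𝕜 N N')}
    (hD : D ⊆ regularConfig 𝕜 N N' β) {W : Fin N → Fin N → Config 𝕜 N N' → ℂ}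
    {W' : Fin N' → Fin N' → Config 𝕜 N N' → ℂ}
    (hW : ∀ j k, j < k → IsPairFactor β D (.inl j) (.inl k) lam (W j k))
    (hW' : ∀ J K, J < K → IsPairFactor β D (.inr J) (.inr K) (1 / lam) (W' J K))
    (p : Config 𝕜 N N') (a : Fin N ⊕ Fin N') {t : 𝕜} (ht : setCoord p a t ∈ D) :
    HasDerivAt (fun s => pairProduct β W W' (setCoord p a s))
      (pairProduct β W W' (setCoord p a t) * logGrad β lam (setCoord p a t) a) t := by
  rw [← logGrad_eq_sum hβ hlam]
  refine hasDerivAt_div_of_logDeriv (hasDerivAt_mul_of_logDeriv ?_ ?_) ?_ ?_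
  · exact hasDerivAt_prod_of_logDeriv _ fun j _ => hasDerivAt_prod_of_logDeriv _ fun k hk =>
      (hW j k (Finset.mem_Ioi.1 hk)).hasDerivAt p a ht
  · exact hasDerivAt_prod_of_logDeriv _ fun j _ => hasDerivAt_prod_of_logDeriv _ fun k hk =>
      (hW' j k (Finset.mem_Ioi.1 hk)).hasDerivAt p a ht
  · exact hasDerivAt_prod_of_logDeriv _ fun j _ => hasDerivAt_prod_of_logDeriv _ fun k _ =>
      (isPairFactor_theta hβ hD (b := .inl j) (c := .inr k) (by simp)).hasDerivAt p a ht
  · exact Finset.prod_ne_zero_iff.2 fun j _ => Finset.prod_ne_zero_iff.2 fun k _ =>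
      theta_coordSub_ne_zero hβ (hD ht) (by simp)

lemma hasDerivAt_logGrad (hβ : 0 < β) (p : Config 𝕜 N N') (a : Fin N ⊕ Fin N') {t : 𝕜}
    (ht : setCoord p a t ∈ regularConfig 𝕜 N N' β) :
    HasDerivAt (fun s => logGrad β lam (setCoord p a s) a)
      (-(lam * charge N N' lam a *
        ∑ b, charge N N' lam b * pairV β (setCoord p a t) a b)) t := by
  rw [← mul_neg, ← Finset.sum_neg_distrib]
  refine HasDerivAt.const_mul _ (HasDerivAt.fun_sum fun b _ => ?_)
  rw [← mul_neg]
  refine HasDerivAt.const_mul _ ?_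
  rw [pairV]
  split_ifs with hab
  -- The diagonal term is the constant `φ(0)`, which is why `pairV` is zero on the diagonal.
  · subst hab
    simp only [coordSub_self, neg_zero]
    exact hasDerivAt_const _ _
  · have h1 := (hasDerivAt_phi hβ (theta_coordSub_ne_zero hβ ht hab)).comp t
      (hasDerivAt_coordSub_setCoord p a a b t)
    exact h1.congr_deriv (by simp [hab])

lemma iteratedDeriv_pairProduct (hβ : 0 < β) (hlam : lam ≠ 0) {D : Set (Config 𝕜 N N')}
    (hDo : IsOpen D) (hD : D ⊆ regularConfig 𝕜 N N' β) {W : Fin N → Fin N → Config 𝕜 N N' → ℂ}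
    {W' : Fin N' → Fin N' → Config 𝕜 N N' → ℂ}
    (hW : ∀ j k, j < k → IsPairFactor β D (.inl j) (.inl k) lam (W j k))
    (hW' : ∀ J K, J < K → IsPairFactor β D (.inr J) (.inr K) (1 / lam) (W' J K))
    {p : Config 𝕜 N N'} (hp : p ∈ D) (a : Fin N ⊕ Fin N') :
    iteratedDeriv 2 (fun s => pairProduct β W W' (setCoord p a s)) (coord p a) =
      pairProduct β W W' p * (logGrad β lam p a ^ 2 -
        lam * charge N N' lam a * ∑ b, charge N N' lam b * pairV β p a b) := by
  have hp' : setCoord p a (coord p a) ∈ D := by rwa [setCoord_coord]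
  rw [iteratedDeriv_succ, iteratedDeriv_one]
  have h1 : deriv (fun s => pairProduct β W W' (setCoord p a s)) =ᶠ[𝓝 (coord p a)]
      fun s => pairProduct β W W' (setCoord p a s) * logGrad β lam (setCoord p a s) a := by
    filter_upwards [(continuous_setCoord p a).continuousAt.eventually (hDo.mem_nhds hp')] with s hs
    exact (hasDerivAt_pairProduct hβ hlam hD hW hW' p a hs).deriv
  have h2 := ((hasDerivAt_pairProduct hβ hlam hD hW hW' p a hp').mul
    (hasDerivAt_logGrad (lam := lam) hβ p a (hD hp')))
  rw [h1.deriv_eq]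
  refine h2.deriv.trans ?_
  simp only [setCoord_coord]
  ring

lemma pairProduct_ne_zero (hβ : 0 < β) {D : Set (Config 𝕜 N N')}
    (hD : D ⊆ regularConfig 𝕜 N N' β) {W : Fin N → Fin N → Config 𝕜 N N' → ℂ}
    {W' : Fin N' → Fin N' → Config 𝕜 N N' → ℂ}
    (hW : ∀ j k, j < k → IsPairFactor β D (.inl j) (.inl k) lam (W j k))
    (hW' : ∀ J K, J < K → IsPairFactor β D (.inr J) (.inr K) (1 / lam) (W' J K))
    {p : Config 𝕜 N N'} (hp : p ∈ D) : pairProduct β W W' p ≠ 0 := by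
  refine div_ne_zero (mul_ne_zero ?_ ?_) ?_ <;>
    refine Finset.prod_ne_zero_iff.2 fun j _ => Finset.prod_ne_zero_iff.2 fun k hk => ?_
  · exact (hW j k (Finset.mem_Ioi.1 hk) p hp).1
  · exact (hW' j k (Finset.mem_Ioi.1 hk) p hp).1
  · exact theta_coordSub_ne_zero hβ (hD hp) (by simp)

lemma contDiffOn_pairProduct (hβ : 0 < β) {D : Set (Config 𝕜 N N')}
    (hD : D ⊆ regularConfig 𝕜 N N' β) {W : Fin N → Fin N → Config 𝕜 N N' → ℂ}
    {W' : Fin N' → Fin N' → Config 𝕜 N N' → ℂ}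
    (hW : ∀ j k, j < k → IsPairFactor β D (.inl j) (.inl k) lam (W j k))
    (hW' : ∀ J K, J < K → IsPairFactor β D (.inr J) (.inr K) (1 / lam) (W' J K)) :
    ContDiffOn 𝕜 2 (pairProduct β W W') D := fun p hp => by
  unfold pairProduct
  simp only [div_eq_mul_inv]
  refine ContDiffAt.contDiffWithinAt (ContDiffAt.mul (ContDiffAt.mul ?_ ?_) (ContDiffAt.inv ?_ ?_))
  · exact contDiffAt_prod fun j _ => contDiffAt_prod fun k hk =>
      (hW j k (Finset.mem_Ioi.1 hk)).contDiffAt hp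
  · exact contDiffAt_prod fun j _ => contDiffAt_prod fun k hk =>
      (hW' j k (Finset.mem_Ioi.1 hk)).contDiffAt hp
  · exact contDiffAt_prod fun j _ => contDiffAt_prod fun k _ =>
      (isPairFactor_theta hβ hD (b := .inl j) (c := .inr k) (by simp)).contDiffAt hp
  · exact Finset.prod_ne_zero_iff.2 fun j _ => Finset.prod_ne_zero_iff.2 fun k _ =>
      theta_coordSub_ne_zero hβ (hD hp) (by simp)

/-- The differences around a triangle add up to zero, so the addition formula with `x = x_a - x_b`,
`y = x_b - x_d` and the parities of `φ` and `V` give the cyclic hypothesis of `sum_mul_sq_sum_eq`.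
-/
lemma sum_charge_mul_sq (hβ : 0 < β) (hM : ∑ a, charge N N' lam a = 0) {p : Config 𝕜 N N'}
    (hp : p ∈ regularConfig 𝕜 N N' β) :
    ∑ a, charge N N' lam a * (∑ b, charge N N' lam b * phi β (coordSub p a b)) ^ 2 =
      ∑ a, ∑ b, charge N N' lam a ^ 2 * charge N N' lam b * pairV β p a b +
        c0 β * ∑ a, charge N N' lam a ^ 3 := by
  refine sum_mul_sq_sum_eq _ hM _ _ _ (fun a b => ?_) (fun a b => ?_) (fun a => by simp [pairV])
    fun a b d hab hbd hda => ?_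
  · rw [coordSub_swap, phi_neg hβ]
  · simp only [pairV, eq_comm (a := b), coordSub_swap p a b, V_neg]
  · have h := phi_addition hβ (theta_coordSub_ne_zero hβ hp hab)
      (theta_coordSub_ne_zero hβ hp hbd)
      (by rw [coordSub_add]; exact theta_coordSub_ne_zero hβ hp hda.symm)
    rw [coordSub_add] at h
    simp only [pairV, if_neg hab, if_neg hbd, if_neg hda]
    rw [coordSub_swap p a d, phi_neg hβ, V_neg]
    linear_combination h

theorem deformedCS_pairProduct (hβ : 0 < β) (hN : 0 < N) (hN' : 0 < N')
    (hlam : lam = (N' : ℂ) / (N : ℂ)) {D : Set (Config 𝕜 N N')}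
    (hDo : IsOpen D) (hD : D ⊆ regularConfig 𝕜 N N' β) {W : Fin N → Fin N → Config 𝕜 N N' → ℂ}
    {W' : Fin N' → Fin N' → Config 𝕜 N N' → ℂ}
    (hW : ∀ j k, j < k → IsPairFactor β D (.inl j) (.inl k) lam (W j k))
    (hW' : ∀ J K, J < K → IsPairFactor β D (.inr J) (.inr K) (1 / lam) (W' J K))
    {p : Config 𝕜 N N'} (hp : p ∈ D) :
    deformedCS 𝕜 N N' β lam (pairProduct β W W') p =
      ((N : ℂ) - (N' : ℂ) ^ 2 / (N : ℂ)) * (c0 β : ℂ) * pairProduct β W W' p := by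
  have hN0 : (N : ℂ) ≠ 0 := by exact_mod_cast hN.ne'
  have hN0' : (N' : ℂ) ≠ 0 := by exact_mod_cast hN'.ne'
  have hlam0 : lam ≠ 0 := by rw [hlam]; exact div_ne_zero hN0' hN0
  -- Neutrality, `N - Ñ/λ = 0`: here the special coupling enters.
  have hM : ∑ a, charge N N' lam a = 0 := by
    simp only [Fintype.sum_sum_type, charge, Sum.elim_inl, Sum.elim_inr, Finset.sum_const,
      Finset.card_univ, Fintype.card_fin, nsmul_eq_mul, hlam]
    field_simp
    ring
  have hM3 : ∑ a, charge N N' lam a ^ 3 = N - N' / lam ^ 3 := by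
    simp only [Fintype.sum_sum_type, charge, Sum.elim_inl, Sum.elim_inr, Finset.sum_const,
      Finset.card_univ, Fintype.card_fin, nsmul_eq_mul]
    ring
  have hsum := sum_charge_mul_sq hβ hM (hD hp)
  rw [hM3] at hsum
  have hd1 (j : Fin N) := iteratedDeriv_pairProduct hβ hlam0 hDo hD hW hW' hp (.inl j)
  have hd2 (J : Fin N') := iteratedDeriv_pairProduct hβ hlam0 hDo hD hW hW' hp (.inr J)
  simp only [setCoord, coord, Sum.elim_inl, Sum.elim_inr] at hd1 hd2
  have hV1 : ∑ j : Fin N, ∑ k ∈ Finset.Ioi j,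
      2 * lam * (lam - 1) * V β (algebraMap 𝕜 ℂ (p.1 j - p.1 k)) =
      lam * (lam - 1) * ∑ j, ∑ k, pairV β p (.inl j) (.inl k) := by
    rw [sum_Ioi_eq_half _ fun j k => by rw [← neg_sub (p.1 j), map_neg, V_neg]]
    simp only [Finset.mul_sum]
    refine Finset.sum_congr rfl fun j _ => Finset.sum_congr rfl fun k _ => ?_
    simp only [pairV, Sum.inl.injEq, coordSub, coord, Sum.elim_inl]
    split_ifs <;> ring
  have hV2 : ∑ J : Fin N', ∑ K ∈ Finset.Ioi J,
      2 * (lam - 1) / lam * V β (algebraMap 𝕜 ℂ (p.2 J - p.2 K)) =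
      (lam - 1) / lam * ∑ j, ∑ k, pairV β p (.inr j) (.inr k) := by
    rw [sum_Ioi_eq_half _ fun j k => by rw [← neg_sub (p.2 j), map_neg, V_neg]]
    simp only [Finset.mul_sum]
    refine Finset.sum_congr rfl fun j _ => Finset.sum_congr rfl fun k _ => ?_
    simp only [pairV, Sum.inr.injEq, coordSub, coord, Sum.elim_inr]
    split_ifs <;> ring
  have hV3 : ∑ j : Fin N, ∑ K : Fin N',
      2 * (1 - lam) * V β (algebraMap 𝕜 ℂ (p.1 j - p.2 K)) =
      2 * (1 - lam) * ∑ j, ∑ k, pairV β p (.inl j) (.inr k) := by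
    simp only [Finset.mul_sum, pairV, reduceCtorEq, if_false, coordSub, coord, Sum.elim_inl,
      Sum.elim_inr]
  have hV4 : ∑ k, ∑ j, pairV β p (.inr k) (.inl j) = ∑ j, ∑ k, pairV β p (.inl j) (.inr k) := by
    rw [Finset.sum_comm]
    refine Finset.sum_congr rfl fun j _ => Finset.sum_congr rfl fun k _ => ?_
    simp only [pairV, reduceCtorEq, if_false]
    rw [coordSub_swap, V_neg]
  set T1 := ∑ j : Fin N, (∑ b, charge N N' lam b * phi β (coordSub p (.inl j) b)) ^ 2 with hT1
  set T2 := ∑ J : Fin N', (∑ b, charge N N' lam b * phi β (coordSub p (.inr J) b)) ^ 2 with hT2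
  set S11 := ∑ j, ∑ k, pairV β p (.inl j) (.inl k) with hS11
  set S12 := ∑ j, ∑ k, pairV β p (.inl j) (.inr k) with hS12
  set S22 := ∑ j, ∑ k, pairV β p (.inr j) (.inr k) with hS22
  have hs1 : ∑ j : Fin N, iteratedDeriv 2
      (fun s => pairProduct β W W' (Function.update p.1 j s, p.2)) (p.1 j) =
      pairProduct β W W' p * (lam ^ 2 * T1 - lam * (S11 - 1 / lam * S12)) := by
    have hY : ∑ j : Fin N, ∑ b, charge N N' lam b * pairV β p (.inl j) b = S11 - 1 / lam * S12 := by
      simp only [Fintype.sum_sum_type, charge, Sum.elim_inl, Sum.elim_inr, one_mul,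
        Finset.sum_add_distrib, ← Finset.mul_sum, hS11, hS12]
      ring
    rw [← hY, hT1, Finset.mul_sum, Finset.mul_sum, ← Finset.sum_sub_distrib, Finset.mul_sum]
    refine Finset.sum_congr rfl fun j _ => ?_
    rw [hd1, logGrad]
    simp only [charge, Sum.elim_inl]
    ring
  have hs2 : ∑ J : Fin N', iteratedDeriv 2
      (fun s => pairProduct β W W' (p.1, Function.update p.2 J s)) (p.2 J) =
      pairProduct β W W' p * (T2 + (S12 - 1 / lam * S22)) := by
    have hY : ∑ j : Fin N', ∑ b, charge N N' lam b * pairV β p (.inr j) b = S12 - 1 / lam * S22 := by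
      simp only [Fintype.sum_sum_type, charge, Sum.elim_inl, Sum.elim_inr, one_mul,
        Finset.sum_add_distrib, ← Finset.mul_sum, ← hV4, hS22]
      ring
    rw [← hY, hT2, ← Finset.sum_add_distrib, Finset.mul_sum]
    refine Finset.sum_congr rfl fun j _ => ?_
    rw [hd2, logGrad]
    simp only [charge, Sum.elim_inr]
    field_simp
    ring
  have hsum' : T1 - 1 / lam * T2 =
      S11 - 1 / lam * S12 + 1 / lam ^ 2 * S12 - 1 / lam ^ 3 * S22 +
        c0 β * (N - N' / lam ^ 3) := by
    simp only [Fintype.sum_sum_type, charge, Sum.elim_inl, Sum.elim_inr, one_mul, one_pow,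
      Finset.sum_add_distrib, ← Finset.mul_sum, hV4] at hsum
    rw [← hS11, ← hS12, ← hS22] at hsum
    rw [hT1, hT2]
    simp only [Fintype.sum_sum_type, charge, Sum.elim_inl, Sum.elim_inr, one_mul,
      ← Finset.mul_sum]
    linear_combination hsum
  rw [deformedCS, hV1, hV2, hV3, hs1, hs2]
  -- The energy is `-λ² c₀` times the sum of the cubed charges.
  have h1 : (N : ℂ) - (N' : ℂ) ^ 2 / N = -(lam ^ 2 * (N - N' / lam ^ 3)) := by
    rw [hlam]; field_simp; ring
  rw [h1]
  have h2 : -(pairProduct β W W' p * (lam ^ 2 * T1 - lam * (S11 - 1 / lam * S12)))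
      + lam * (pairProduct β W W' p * (T2 + (S12 - 1 / lam * S22))) =
      pairProduct β W W' p * (-lam ^ 2 * (T1 - 1 / lam * T2)
        + lam * S11 + (lam - 1) * S12 - S22) := by
    field_simp
    ring
  rw [hsum'] at h2
  linear_combination (norm := skip) h2
  field_simp
  ring

end GroundState

/-! ### Real configurations and principal powers. -/

section RealConfigurations

variable {N N' : ℕ} {β : ℝ}

/-- For real `r`, conjugation exchanges the two Euler products, since `e^{-β}` is real, and fixes
the sine. -/
lemma theta_ofReal_im (hβ : 0 < β) (r : ℝ) : (theta β r).im = 0 := by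
  rw [← Complex.conj_eq_iff_im, theta_eq hβ, thetaProd, map_mul, map_mul]
  have h2 (u : ℂ) : (starRingEnd ℂ) (eulerProd (cexp (-β)) u) =
      eulerProd (cexp (-β)) ((starRingEnd ℂ) u) := by
    have h3 := (multipliable_eulerProd (norm_exp_neg_lt_one hβ) u).map_tprod (starRingEnd ℂ)
      Complex.continuous_conj
    rw [eulerProd, h3, eulerProd]
    refine tprod_congr fun n => ?_
    simp [← Complex.exp_conj]
  rw [h2, h2, ← Complex.exp_conj, ← Complex.exp_conj, ← Complex.sin_conj]
  simp only [map_mul, map_neg, conj_I, conj_ofReal, neg_mul, neg_neg, map_div₀, map_ofNat]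
  ring

lemma isOpen_regularConfig_real (hβ : 0 < β) : IsOpen (regularConfig ℝ N N' β) := by
  have h : regularConfig ℝ N N' β = ⋂ b, ⋂ c, ⋂ _ : b ≠ c,
      {p : Config ℝ N N' | theta β (coordSub p b c) ≠ 0} := by
    ext p
    simp only [mem_iInter]
    refine ⟨fun hp b c hbc => theta_coordSub_ne_zero hβ hp hbc, fun hp => ⟨fun j k hjk => ?_,
      fun j k hjk => ?_, fun j k => ?_⟩⟩
    · exact (offLattice_iff hβ).2 (hp (.inl j) (.inl k) (by simpa using hjk))
    · exact (offLattice_iff hβ).2 (hp (.inr j) (.inr k) (by simpa using hjk))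
    · exact (offLattice_iff hβ).2 (hp (.inl j) (.inr k) (by simp))
  rw [h]
  refine isOpen_iInter_of_finite fun b => isOpen_iInter_of_finite fun c =>
    isOpen_iInter_of_finite fun _ => ?_
  exact isOpen_ne_fun ((differentiable_theta hβ).continuous.comp
    (contDiff_coordSub b c).continuous) continuous_const

lemma offLattice_ofReal {r : ℝ} (h0 : r ≠ 0) (h1 : |r| < 1) :
    OffLattice β (r : ℂ) := by
  intro a b h
  have him := congrArg Complex.im h
  have hre := congrArg Complex.re h
  simp only [ofReal_im, add_im, mul_im, mul_re, I_re, I_im, ofReal_re, re_ofNat, im_ofNat,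
    intCast_re, intCast_im, add_re, mul_zero, zero_mul, add_zero, zero_add, sub_zero, one_mul,
    sub_self] at him hre
  have ha : a ≠ 0 := by rintro rfl; simp at hre; exact h0 hre
  have ha' : (1 : ℝ) ≤ |(a : ℝ)| := by exact_mod_cast Int.one_le_abs ha
  rw [hre, abs_mul, abs_of_pos (by positivity)] at h1
  nlinarith [Real.pi_gt_three]

lemma regularConfig_real_nonempty : (regularConfig ℝ N N' β).Nonempty := by
  -- Distinct points of `(0, 1)`: their differences are non-zero and smaller than the period `2π`.
  let e : Fin N ⊕ Fin N' → ℝ := fun a => 1 / ((finSumFinEquiv a : ℕ) + 2 : ℝ)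
  have he (a b : Fin N ⊕ Fin N') (hab : a ≠ b) : OffLattice β ((e a - e b : ℝ) : ℂ) := by
    have hb (a : Fin N ⊕ Fin N') : 0 < e a ∧ e a < 1 := by
      have : (0 : ℝ) ≤ (finSumFinEquiv a : ℕ) := Nat.cast_nonneg _
      exact ⟨by positivity, by simp only [e]; rw [div_lt_one (by positivity)]; linarith⟩
    refine offLattice_ofReal (fun h => hab ?_) (abs_lt.2 ⟨?_, ?_⟩)
    · have h1 : e a = e b := sub_eq_zero.1 h
      simp only [e, one_div, inv_inj, add_left_inj, Nat.cast_inj] at h1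
      exact finSumFinEquiv.injective (Fin.ext h1)
    · linarith [(hb a).1, (hb b).2]
    · linarith [(hb a).2, (hb b).1]
  exact ⟨(fun j => e (.inl j), fun J => e (.inr J)), fun j k hjk => he _ _ (by simpa using hjk),
    fun j k hjk => he _ _ (by simpa using hjk), fun j k => he _ _ (by simp)⟩

/-- The principal logarithm is continuous at negative reals when approached from `Im ≥ 0`, in
particular along the real axis. -/
lemma continuousOn_log_of_im_eq_zero {E : Type*} [TopologicalSpace E] {D : Set E} {w : E → ℂ}
    (hw : ContinuousOn w D) (h0 : ∀ p ∈ D, w p ≠ 0) (him : ∀ p ∈ D, (w p).im = 0) :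
    ContinuousOn (fun p => log (w p)) D := fun p hp => by
  by_cases h : w p ∈ slitPlane
  · exact (hw p hp).clog h
  · have hre : (w p).re < 0 := by
      rw [mem_slitPlane_iff, not_or, not_lt] at h
      refine lt_of_le_of_ne h.1 fun h' => h0 p hp (Complex.ext h' (him p hp))
    have h1 := continuousWithinAt_log_of_re_neg_of_im_zero hre (him p hp)
    exact h1.comp (hw p hp) fun s hs => (him s hs).ge

lemma isPairFactor_cpow (hβ : 0 < β) {b c : Fin N ⊕ Fin N'} (hbc : b ≠ c) (g : ℂ) :
    IsPairFactor β (regularConfig ℝ N N' β) b c g fun p => theta β (coordSub p b c) ^ g := by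
  have h0 (p : Config ℝ N N') (hp : p ∈ regularConfig ℝ N N' β) :=
    theta_coordSub_ne_zero hβ hp hbc
  refine isPairFactor_exp hβ (isOpen_regularConfig_real hβ) subset_rfl hbc
    (L := fun p => log (theta β (coordSub p b c))) ?_ (fun p hp => exp_log (h0 p hp))
    fun p hp => by rw [cpow_def_of_ne_zero (h0 p hp), mul_comm]
  refine continuousOn_log_of_im_eq_zero ?_ h0 fun p _ => theta_ofReal_im hβ _
  exact ((differentiable_theta hβ).continuous.comp (contDiff_coordSub b c).continuous).continuousOn

end RealConfigurations

lemma isEigenfunctionOn_pairProduct {𝕜 : Type} [NontriviallyNormedField 𝕜] [NormedAlgebra 𝕜 ℂ]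
    {N N' : ℕ} {β : ℝ} {lam : ℂ} (hβ : 0 < β) (hN : 0 < N) (hN' : 0 < N')
    (hlam : lam = (N' : ℂ) / (N : ℂ)) {D : Set (Config 𝕜 N N')} (hDo : IsOpen D)
    (hDn : D.Nonempty) (hD : D ⊆ regularConfig 𝕜 N N' β) {W : Fin N → Fin N → Config 𝕜 N N' → ℂ}
    {W' : Fin N' → Fin N' → Config 𝕜 N N' → ℂ}
    (hW : ∀ j k, j < k → IsPairFactor β D (.inl j) (.inl k) lam (W j k))
    (hW' : ∀ J K, J < K → IsPairFactor β D (.inr J) (.inr K) (1 / lam) (W' J K)) :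
    IsEigenfunctionOn 𝕜 N N' β lam D (pairProduct β W W')
      (((N : ℂ) - (N' : ℂ) ^ 2 / (N : ℂ)) * (c0 β : ℂ)) where
  contDiffOn := contDiffOn_pairProduct hβ hD hW hW'
  nonzero := hDn.imp fun _ hp => ⟨hp, pairProduct_ne_zero hβ hD hW hW' hp⟩
  eigen _ hp := deformedCS_pairProduct hβ hN hN' hlam hDo hD hW hW' hp

end EllipticCS

end

theorem corollary2 (N N' : ℕ) (hN : 0 < N) (hN' : 0 < N') (β : ℝ) (hβ : 0 < β)
    (lam : ℂ) (hlam : lam = (N' : ℂ) / (N : ℂ)) :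
    EllipticCS.IsEigenfunctionOn ℝ N N' β lam (EllipticCS.regularConfig ℝ N N' β)
      (EllipticCS.psi0 N N' β lam)
      (((N : ℂ) - (N' : ℂ) ^ 2 / (N : ℂ)) * (EllipticCS.c0 β : ℂ)) ∧
    ∀ U : Set (EllipticCS.Config ℂ N N'), IsOpen U → U.Nonempty →
      U ⊆ EllipticCS.regularConfig ℂ N N' β →
      ∀ (L : Fin N → Fin N → EllipticCS.Config ℂ N N' → ℂ)
        (L' : Fin N' → Fin N' → EllipticCS.Config ℂ N N' → ℂ),
        EllipticCS.IsLogBranch N N' β U L L' →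
        EllipticCS.IsEigenfunctionOn ℂ N N' β lam U
          (EllipticCS.psi0Branch N N' β lam L L')
          (((N : ℂ) - (N' : ℂ) ^ 2 / (N : ℂ)) * (EllipticCS.c0 β : ℂ)) := by
  refine ⟨?_, fun U hU hUn hUr L L' hL => ?_⟩
  -- `psi0` and `psi0Branch` agree with `pairProduct` by unfolding; only the pair factors depend on
  -- the setting.
  · exact EllipticCS.isEigenfunctionOn_pairProduct hβ hN hN' hlam
      (EllipticCS.isOpen_regularConfig_real hβ) (EllipticCS.regularConfig_real_nonempty)
      subset_rfl
      (fun j k hjk => EllipticCS.isPairFactor_cpow hβ (b := .inl j) (c := .inl k)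
        (by simpa using hjk.ne) lam)
      (fun j k hjk => EllipticCS.isPairFactor_cpow hβ (b := .inr j) (c := .inr k)
        (by simpa using hjk.ne) (1 / lam))
  · exact EllipticCS.isEigenfunctionOn_pairProduct hβ hN hN' hlam hU hUn hUr
      (fun j k hjk => EllipticCS.isPairFactor_exp hβ hU hUr (by simpa using hjk.ne)
        (hL.continuousOn_left j k hjk) (hL.exp_left j k hjk) fun _ _ => rfl)
      (fun j k hjk => EllipticCS.isPairFactor_exp hβ hU hUr (by simpa using hjk.ne)
        (hL.continuousOn_right j k hjk) (hL.exp_right j k hjk) fun _ _ => rfl)
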